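/- For every $\delta>0$ there exists a constant $c(\delta)>0$, depending only on $\delta$, such that the following holds. Let $n,m$ be positive integers with $(1+\delta)n<m<n e^{n/2}$, let $P_1,\dots,P_m$ be independent random vectors uniformly distributed on the Euclidean unit sphere $S^{n-1}\subset\mathbb{R}^n$, and let $K=\operatorname{conv}\{\pm P_1,\dots,\pm P_m\}$. Then, with probability greater than $1-e^{-n}$, $$|K|^{1/n}\;\ge\; c(\delta)\,\frac{\sqrt{\log (m/n)}}{n},$$ where $|K|$ denotes the $n$-dimensional volume (Lebesgue measure) of $K$. -/

import Mathlib

open MeasureTheory ProbabilityTheory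

/-- The uniform (rotation invariant, normalized surface) probability measure `σ` on the unit
sphere `S^{n-1}` of the Euclidean space `ℝⁿ`, `n ≥ 1`. -/
noncomputable def sphereUniform (n : ℕ) :
    Measure (Metric.sphere (0 : EuclideanSpace ℝ (Fin n)) 1) :=
  ((volume : Measure (EuclideanSpace ℝ (Fin n))).toSphere Set.univ)⁻¹ •
    (volume : Measure (EuclideanSpace ℝ (Fin n))).toSphere

/-- The symmetric convex hull `conv{±p₁, …, ±pₘ}`. -/
def symmConvexHull {n m : ℕ} (p : Fin m → EuclideanSpace ℝ (Fin n)) :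
    Set (EuclideanSpace ℝ (Fin n)) :=
  convexHull ℝ (Set.range p ∪ Set.range fun i => -p i)

/-!
The symmetric hull `K` contains, with probability greater than `1 - e⁻ⁿ`, a Euclidean ball of radius
`r` of order `√(log (m / n) / n)`, hence a cube of side `2 r / √n`, and this gives the volume bound.

A ball of radius `r` lies in `K` if and only if the support function
`θ ↦ max_i |⟪P_i, θ⟫|` is at least `r` on the unit sphere. A direct union bound over a net is too
weak, because the support function may vary too quickly compared with its typical size. It is
therefore bounded below by a smoother seminorm, `blockSum`: split the points into `N ≥ n` blocks of
`k` points with `N k ≤ m` and average over the blocks the maximum of `|⟪P_i, θ⟫|` in the block.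
The average is over independent terms, so its upper and lower deviations at a fixed `θ` are
exponentially small in `N` (`pi_real_le_sum_le`), and its supremum over the sphere is comparable to
its size at one point. A net of mesh independent of `n`, thus of `Cⁿ` points, is then enough
(`pi_real_exists_blockSum_lt_le`).

The one-dimensional estimates on the sphere are obtained by comparing volumes of cones, balls and
slabs: the upper tail `sphereUniform_le_inner`, the small-ball estimate `sphereUniform_abs_inner_lt`
and the lower bound for the tail `le_sphereUniform_le_inner`.

Two choices of blocks are used. With `k = 1` and `N = m` the small-ball estimate gives a ball of
radius `s(δ) / √n` for every `m > (1 + δ) n` (`exists_blockSum_one_bound`), which suffices while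
`m / n` is bounded. With `N = n` and `k = ⌊m / n⌋` large, the maximum in a block is of order
`√(log k / n)` with probability close to one, because a single marginal exceeds a small multiple of
this with probability at least of order `k ^ (-3 / 8)` (`blockSum_large_bound`). This is where
`m < n e ^ (n / 2)` enters: it keeps the level `√(log k / n)` bounded by a constant below one.
-/

open Metric Set Real
open scoped Pointwise RealInnerProductSpace

/-! ### One-dimensional marginals of the uniform measure on the sphere -/

theorem volume_unitBall_pos (n : ℕ) :
    0 < volume.real (ball (0 : EuclideanSpace ℝ (Fin n)) 1) :=
  ENNReal.toReal_pos (measure_ball_pos _ _ one_pos).ne' measure_ball_lt_top.ne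

theorem volume_ne_top_of_norm_lt_one {n : ℕ} {A : Set (EuclideanSpace ℝ (Fin n))}
    (hA : ∀ x ∈ A, ‖x‖ < 1) : volume A ≠ ⊤ :=
  (measure_lt_top_of_subset (s := ball 0 1) (fun x hx => mem_ball_zero_iff.2 (hA x hx))
    measure_ball_lt_top.ne).ne

instance isProbabilityMeasure_sphereUniform (n : ℕ) [NeZero n] :
    IsProbabilityMeasure (sphereUniform n) := by
  constructor
  have h : (volume : Measure (EuclideanSpace ℝ (Fin n))).toSphere univ ≠ 0 := by
    rw [Measure.measure_univ_ne_zero, Ne, Measure.toSphere_eq_zero_iff_finrank]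
    simpa using NeZero.ne n
  rw [sphereUniform, Measure.smul_apply, smul_eq_mul,
    ENNReal.inv_mul_cancel h (measure_ne_top _ _)]

/-- The uniform measure of a set is the proportion of the unit ball filled by the cone over it. -/
theorem sphereUniform_real_mul {n : ℕ} [NeZero n]
    {s : Set (sphere (0 : EuclideanSpace ℝ (Fin n)) 1)} (hs : MeasurableSet s) :
    (sphereUniform n).real s * volume.real (ball (0 : EuclideanSpace ℝ (Fin n)) 1) =
      volume.real (Ioo (0 : ℝ) 1 • ((↑) '' s : Set (EuclideanSpace ℝ (Fin n)))) := by
  have hn : (n : ℝ) ≠ 0 := by simpa using NeZero.ne n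
  have hb := (volume_unitBall_pos n).ne'
  rw [sphereUniform, measureReal_ennreal_smul_apply, ENNReal.toReal_inv, ← measureReal_def,
    Measure.toSphere_real_apply_univ, measureReal_def _ s, Measure.toSphere_apply' _ hs,
    ENNReal.toReal_mul, ← measureReal_def]
  simp only [finrank_euclideanSpace, Fintype.card_fin, ENNReal.toReal_natCast]
  field_simp

theorem sphereUniform_real_mul_le {n : ℕ} [NeZero n]
    {s : Set (sphere (0 : EuclideanSpace ℝ (Fin n)) 1)} (hs : MeasurableSet s)
    {B : Set (EuclideanSpace ℝ (Fin n))} (hB : volume B ≠ ⊤)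
    (h : ∀ p ∈ s, ∀ r : ℝ, 0 < r → r < 1 → r • (p : EuclideanSpace ℝ (Fin n)) ∈ B) :
    (sphereUniform n).real s * volume.real (ball (0 : EuclideanSpace ℝ (Fin n)) 1) ≤
      volume.real B := by
  rw [sphereUniform_real_mul hs]
  refine measureReal_mono ?_ hB
  rintro _ ⟨r, hr, _, ⟨p, hp, rfl⟩, rfl⟩
  exact h p hp r hr.1 hr.2

theorem measurableSet_le_inner {n : ℕ} (θ : EuclideanSpace ℝ (Fin n)) (t : ℝ) :
    MeasurableSet {p : sphere (0 : EuclideanSpace ℝ (Fin n)) 1 |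
      t ≤ ⟪(p : EuclideanSpace ℝ (Fin n)), θ⟫} :=
  measurableSet_le measurable_const (Continuous.measurable (by fun_prop))

theorem volume_real_affine_image {n : ℕ} {ρ : ℝ} (hρ : 0 ≤ ρ) (v : EuclideanSpace ℝ (Fin n))
    (S : Set (EuclideanSpace ℝ (Fin n))) :
    volume.real ((fun x => ρ • x + v) '' S) = ρ ^ n * volume.real S := by
  have : (fun x => ρ • x + v) '' S = (fun x => x + v) '' (ρ • S) := by
    rw [← image_smul, image_image]
  rw [this, image_add_right, measureReal_def, measure_preimage_add_right,
    Measure.addHaar_smul, ENNReal.toReal_mul, measureReal_def]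
  simp [abs_of_nonneg hρ, ENNReal.toReal_ofReal, pow_nonneg hρ]

/-- Upper tail of a one-dimensional marginal of the sphere: the cone over the cap of height `t` lies
in a ball centred at `(t / 2) θ` of squared radius `1 - 3 t² / 4 ≤ exp (-3 t² / 4)`. -/
theorem sphereUniform_le_inner {n : ℕ} [NeZero n] {θ : EuclideanSpace ℝ (Fin n)} (hθ : ‖θ‖ = 1)
    {t : ℝ} (ht : 0 ≤ t) :
    (sphereUniform n).real {p | t ≤ ⟪(p : EuclideanSpace ℝ (Fin n)), θ⟫} ≤
      exp (-(3 * n * t ^ 2 / 8)) := by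
  have key := sphereUniform_real_mul_le (measurableSet_le_inner θ t)
    (B := closedBall ((t / 2) • θ) (exp (-(3 * t ^ 2 / 8)))) measure_closedBall_lt_top.ne ?_
  · rw [measureReal_def (s := closedBall _ _), Measure.addHaar_closedBall _ _ (exp_pos _).le,
      ENNReal.toReal_mul, ← measureReal_def, ENNReal.toReal_ofReal (by positivity)] at key
    have := le_of_mul_le_mul_right key (volume_unitBall_pos n)
    refine this.trans_eq ?_
    rw [finrank_euclideanSpace, Fintype.card_fin, ← exp_nat_mul]
    congr 1; ring
  · intro p hp r hr0 hr1
    have hp' : t ≤ ⟪(p : EuclideanSpace ℝ (Fin n)), θ⟫ := hp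
    have hpn : ‖(p : EuclideanSpace ℝ (Fin n))‖ = 1 := by simp
    have ht1 : t ≤ 1 := hp'.trans ((real_inner_le_norm _ _).trans (by rw [hpn, hθ, one_mul]))
    rw [mem_closedBall, dist_eq_norm]
    refine le_of_sq_le_sq ?_ (exp_pos _).le
    rw [norm_sub_sq_real, norm_smul, norm_smul, hpn, hθ, real_inner_smul_left,
      real_inner_smul_right, ← exp_nat_mul]
    have h1 : 1 - 3 * t ^ 2 / 4 ≤ exp ((2 : ℕ) * -(3 * t ^ 2 / 8)) := by
      have := add_one_le_exp ((2 : ℕ) * -(3 * t ^ 2 / 8))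
      push_cast at this ⊢
      linarith
    refine le_trans ?_ h1
    simp only [norm_eq_abs, mul_one, sq_abs]
    nlinarith [mul_nonneg (mul_nonneg hr0.le ht) (sub_nonneg.2 hp'),
      mul_nonneg (sub_nonneg.2 hr1.le) (sub_nonneg.2 ht1),
      mul_nonneg (mul_nonneg (sub_nonneg.2 hr1.le) (sub_nonneg.2 ht1)) ht,
      mul_nonneg (sub_nonneg.2 hr1.le) hr0.le]

theorem sphereUniform_le_abs_inner {n : ℕ} [NeZero n] {θ : EuclideanSpace ℝ (Fin n)}
    (hθ : ‖θ‖ = 1) {t : ℝ} (ht : 0 ≤ t) :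
    (sphereUniform n).real {p | t ≤ |⟪(p : EuclideanSpace ℝ (Fin n)), θ⟫|} ≤
      2 * exp (-(3 * n * t ^ 2 / 8)) := by
  have hsub : {p : sphere (0 : EuclideanSpace ℝ (Fin n)) 1 |
      t ≤ |⟪(p : EuclideanSpace ℝ (Fin n)), θ⟫|} ⊆
      {p | t ≤ ⟪(p : EuclideanSpace ℝ (Fin n)), θ⟫} ∪
        {p | t ≤ ⟪(p : EuclideanSpace ℝ (Fin n)), -θ⟫} := by
    intro p hp
    have hp' : t ≤ |⟪(p : EuclideanSpace ℝ (Fin n)), θ⟫| := hp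
    rcases le_abs.1 hp' with h | h
    · exact Or.inl h
    · exact Or.inr (by simpa [inner_neg_right] using h)
  have h1 := sphereUniform_le_inner hθ ht
  have h2 := sphereUniform_le_inner (n := n) (θ := -θ) (by rwa [norm_neg]) ht
  have := (measureReal_mono (μ := sphereUniform n) hsub).trans (measureReal_union_le _ _)
  linarith

/-- If `T` is stable under division by numbers in `(0, 1)`, then the points of the unit ball with
`⟪x, θ⟫ ∈ T` lie in the cone over the points of the sphere with this property. Keeping `T` away from
`0` excludes the apex of the cone. -/
theorem volume_real_le_abs_inner {n : ℕ} [NeZero n] (θ : EuclideanSpace ℝ (Fin n)) {t : ℝ}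
    (ht : 0 < t) {T : Set ℝ} (hT : MeasurableSet T) (hTt : ∀ y ∈ T, t ≤ |y|)
    (hcone : ∀ y ∈ T, ∀ r : ℝ, 0 < r → r < 1 → y / r ∈ T) :
    volume.real {x : EuclideanSpace ℝ (Fin n) | ‖x‖ < 1 ∧ ⟪x, θ⟫ ∈ T} ≤
      (sphereUniform n).real {p | ⟪(p : EuclideanSpace ℝ (Fin n)), θ⟫ ∈ T} *
        volume.real (ball (0 : EuclideanSpace ℝ (Fin n)) 1) := by
  have hm : MeasurableSet {p : sphere (0 : EuclideanSpace ℝ (Fin n)) 1 |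
      ⟪(p : EuclideanSpace ℝ (Fin n)), θ⟫ ∈ T} :=
    measurableSet_preimage (Continuous.measurable (by fun_prop)) hT
  rw [sphereUniform_real_mul hm]
  refine measureReal_mono ?_ ?_
  · rintro x ⟨hx1, hx2⟩
    have hx0 : x ≠ 0 := by
      rintro rfl
      have := hTt _ hx2
      simp at this
      linarith
    have hxn : 0 < ‖x‖ := norm_pos_iff.2 hx0
    refine ⟨‖x‖, ⟨hxn, hx1⟩, ‖x‖⁻¹ • x, ⟨⟨‖x‖⁻¹ • x, ?_⟩, ?_, rfl⟩, ?_⟩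
    · simp [norm_smul, hxn.ne']
    · have := hcone _ hx2 ‖x‖ hxn hx1
      simpa [real_inner_smul_left, div_eq_inv_mul] using this
    · simp [smul_smul, hxn.ne']
  · refine volume_ne_top_of_norm_lt_one ?_
    rintro _ ⟨r, hr, _, ⟨p, -, rfl⟩, rfl⟩
    simp [norm_smul, abs_of_pos hr.1, hr.2]

/-- Relative to the volume of the ball, a slab of the unit ball has volume at most of the order of
`√n` times its width: shrinking the slab slightly makes room for many disjoint translates of it in
the ball. -/
theorem volume_real_slab_le {n : ℕ} [NeZero n] {θ : EuclideanSpace ℝ (Fin n)} (hθ : ‖θ‖ = 1)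
    {u : ℝ} (hu : 0 < u) :
    volume.real {x : EuclideanSpace ℝ (Fin n) | ‖x‖ < 1 ∧ |⟪x, θ⟫| < u} ≤
      8 * √n * u * volume.real (ball (0 : EuclideanSpace ℝ (Fin n)) 1) := by
  set S := {x : EuclideanSpace ℝ (Fin n) | ‖x‖ < 1 ∧ |⟪x, θ⟫| < u} with hS
  set V := volume.real (ball (0 : EuclideanSpace ℝ (Fin n)) 1) with hV
  have hV0 : 0 < V := volume_unitBall_pos n
  have hn1 : (1 : ℝ) ≤ n := by exact_mod_cast NeZero.one_le
  have hs0 : 0 < √(n : ℝ) := by positivity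
  have hsq : √(n : ℝ) ^ 2 = n := sq_sqrt (by positivity)
  have hSm : MeasurableSet S := by
    refine (IsOpen.inter (s := {x : EuclideanSpace ℝ (Fin n) | ‖x‖ < 1})
      (t := {x | |⟪x, θ⟫| < u}) ?_ ?_).measurableSet
    · exact isOpen_lt (by fun_prop) (by fun_prop)
    · exact isOpen_lt (by fun_prop) (by fun_prop)
  -- For wide slabs the right-hand side exceeds the volume of the ball.
  rcases lt_or_ge 1 (4 * √(n : ℝ) * u) with hbig | hsmall
  · have : volume.real S ≤ V :=
      measureReal_mono (fun x hx => by simpa using hx.1) measure_ball_lt_top.ne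
    nlinarith
  set J := ⌊1 / (4 * √(n : ℝ) * u)⌋₊ with hJ
  have hJle : (J : ℝ) * (4 * √(n : ℝ) * u) ≤ 1 := by
    rw [← le_div_iff₀ (by positivity)]
    exact Nat.floor_le (by positivity)
  have hJlt : 1 < ((J : ℝ) + 1) * (4 * √(n : ℝ) * u) := by
    rw [← div_lt_iff₀ (by positivity)]
    exact Nat.lt_floor_add_one _
  set ρ : ℝ := √(1 - 3 / (4 * n)) with hρ
  have h34 : 3 / (4 * (n : ℝ)) ≤ 3 / 4 := by
    rw [div_le_div_iff₀ (by positivity) (by norm_num)]; linarith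
  have hρ0 : 0 ≤ ρ := sqrt_nonneg _
  have hρsq : ρ ^ 2 = 1 - 3 / (4 * n) := sq_sqrt (by linarith)
  have hρ1 : ρ ≤ 1 := by
    rw [hρ, sqrt_le_one]
    have : 0 ≤ 3 / (4 * (n : ℝ)) := by positivity
    linarith
  have hρn : 1 / 2 ≤ ρ ^ n := by
    refine le_of_sq_le_sq ?_ (by positivity)
    rw [← pow_mul, mul_comm, pow_mul, hρsq]
    have := one_add_mul_le_pow (a := -(3 / (4 * (n : ℝ)))) (by linarith) n
    have h2 : (n : ℝ) * -(3 / (4 * (n : ℝ))) = -(3 / 4) := by field_simp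
    rw [h2] at this
    rw [sub_eq_add_neg]
    refine le_trans (by norm_num) this
  -- `T j` maps the slab into the ball, near height `2 u j`; the images are disjoint for `j ≤ J`.
  let T : ℕ → EuclideanSpace ℝ (Fin n) → EuclideanSpace ℝ (Fin n) :=
    fun j x => ρ • x + (2 * u * j) • θ
  have hinner : ∀ j x, ⟪T j x, θ⟫ = ρ * ⟪x, θ⟫ + 2 * u * j := by
    intro j x
    simp only [T, inner_add_left, real_inner_smul_left, real_inner_self_eq_norm_sq, hθ]
    ring
  have hclose : ∀ j, ∀ x ∈ S, |⟪T j x, θ⟫ - 2 * u * j| < u := by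
    intro j x hx
    rw [hinner, add_sub_cancel_right, abs_mul, abs_of_nonneg hρ0]
    exact (mul_le_of_le_one_left (abs_nonneg _) hρ1).trans_lt hx.2
  have hdisj : (↑(Finset.range (J + 1)) : Set ℕ).PairwiseDisjoint fun j => T j '' S := by
    intro i _ j _ hij
    rw [Function.onFun, Set.disjoint_left]
    rintro _ ⟨x, hx, rfl⟩ ⟨y, hy, hxy⟩
    have h1 := hclose i x hx
    have h2 := hclose j y hy
    rw [hxy] at h2
    have h3 : |2 * u * (i : ℝ) - 2 * u * j| < 2 * u := by
      calc _ = |(⟪T i x, θ⟫ - 2 * u * j) - (⟪T i x, θ⟫ - 2 * u * i)| := by ring_nf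
        _ ≤ _ := abs_sub _ _
        _ < 2 * u := by linarith
    rw [← mul_sub, abs_mul, abs_of_pos (by positivity : 0 < 2 * u)] at h3
    have h4 : |(i : ℝ) - j| < 1 := by
      by_contra hc
      push Not at hc
      nlinarith
    have h5 : |(i : ℤ) - j| < 1 := by exact_mod_cast h4
    rw [Int.abs_lt_one_iff] at h5
    omega
  have hTball : (⋃ j ∈ Finset.range (J + 1), T j '' S) ⊆ ball 0 1 := by
    simp only [iUnion_subset_iff]
    rintro j hj _ ⟨x, hx, rfl⟩
    have hjJ : (j : ℝ) ≤ J := by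
      exact_mod_cast Nat.lt_succ_iff.1 (Finset.mem_range.1 hj)
    rw [mem_ball_zero_iff]
    refine lt_of_pow_lt_pow_left₀ 2 zero_le_one ?_
    have hx1 : ‖x‖ ^ 2 < 1 := by
      have := hx.1
      nlinarith [norm_nonneg x]
    have hxu := (abs_lt.1 hx.2).2
    have e : ‖T j x‖ ^ 2 = ρ ^ 2 * ‖x‖ ^ 2 + 2 * ρ * (2 * u * j) * ⟪x, θ⟫ + (2 * u * j) ^ 2 := by
      simp only [T, norm_add_sq_real, norm_smul, real_inner_smul_left, real_inner_smul_right, hθ,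
        norm_eq_abs, mul_pow, sq_abs]
      ring
    set w : ℝ := √n * u with hw
    have hw0 : 0 < w := by positivity
    have hw1 : 4 * w ≤ 1 := by rw [hw]; linarith
    have hjw : (j : ℝ) * (4 * w) ≤ 1 := by
      refine le_trans ?_ (hJle)
      rw [hw]
      have : 0 < 4 * √(n : ℝ) * u := by positivity
      nlinarith
    have hcross : 2 * ρ * (2 * u * j) * ⟪x, θ⟫ ≤ 2 * (2 * u * j) * u := by
      have hj0 : (0 : ℝ) ≤ 2 * u * j := by positivity
      calc 2 * ρ * (2 * u * j) * ⟪x, θ⟫ ≤ 2 * ρ * (2 * u * j) * u := by gcongr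
        _ ≤ 2 * 1 * (2 * u * j) * u := by gcongr
        _ = _ := by ring
    have hfin : (2 * (2 * u * j) * u + (2 * u * j) ^ 2) ≤ 3 / (4 * n) := by
      rw [le_div_iff₀ (by positivity)]
      have : (2 * (2 * u * j) * u + (2 * u * j) ^ 2) * (4 * n) =
          16 * (j * w) * w + 16 * (j * w) ^ 2 := by
        rw [hw]; linear_combination (-(16 * j * u ^ 2) - 16 * j ^ 2 * u ^ 2) * hsq
      rw [this]
      have : 0 ≤ (j : ℝ) * w := by positivity
      nlinarith
    rw [e, one_pow]
    have hρpos : 0 < ρ ^ 2 := by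
      rw [hρsq]; linarith
    nlinarith
  have hTm : ∀ j ∈ Finset.range (J + 1), MeasurableSet (T j '' S) := by
    intro j _
    have hρne : ρ ≠ 0 := by
      rintro h0
      rw [h0] at hρsq
      linarith
    have : T j = (fun x => x + (2 * u * j) • θ) ∘ (fun x => ρ • x) := rfl
    rw [this, image_comp, image_add_right, image_smul]
    exact (hSm.const_smul_of_ne_zero hρne).preimage (measurable_add_const _)
  have hsum : volume.real (⋃ j ∈ Finset.range (J + 1), T j '' S) ≤ V :=
    measureReal_mono hTball measure_ball_lt_top.ne
  rw [measureReal_biUnion_finset hdisj hTm (fun j hj => (measure_lt_top_of_subset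
    ((subset_biUnion_of_mem (u := fun j => T j '' S) hj).trans hTball)
      measure_ball_lt_top.ne).ne)] at hsum
  simp only [T, volume_real_affine_image hρ0, Finset.sum_const, Finset.card_range,
    nsmul_eq_mul] at hsum
  push_cast at hsum
  have hS0 : 0 ≤ volume.real S := measureReal_nonneg
  have h1 : ((J : ℝ) + 1) * (1 / 2 * volume.real S) ≤ V := by
    refine le_trans ?_ hsum
    gcongr
  have h2 : volume.real S ≤ ((J : ℝ) + 1) * (4 * √n * u) * volume.real S :=
    le_mul_of_one_le_left hS0 hJlt.le
  have h3 : 0 < 8 * √(n : ℝ) * u := by positivity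
  calc volume.real S ≤ 8 * √n * u * (((J : ℝ) + 1) * (1 / 2 * volume.real S)) := by
        linarith
    _ ≤ 8 * √n * u * V := by gcongr

/-- Small-ball estimate for a one-dimensional marginal of the sphere. -/
theorem sphereUniform_abs_inner_lt {n : ℕ} [NeZero n] {θ : EuclideanSpace ℝ (Fin n)}
    (hθ : ‖θ‖ = 1) {u : ℝ} (hu : 0 < u) :
    (sphereUniform n).real {p | |⟪(p : EuclideanSpace ℝ (Fin n)), θ⟫| < u} ≤ 8 * √n * u := by
  have hm : MeasurableSet {p : sphere (0 : EuclideanSpace ℝ (Fin n)) 1 |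
      |⟪(p : EuclideanSpace ℝ (Fin n)), θ⟫| < u} :=
    measurableSet_lt (Continuous.measurable (by fun_prop)) measurable_const
  refine le_of_mul_le_mul_right (le_trans (sphereUniform_real_mul_le hm
    (B := {x | ‖x‖ < 1 ∧ |⟪x, θ⟫| < u}) ?_ ?_) (volume_real_slab_le hθ hu))
    (volume_unitBall_pos n)
  · exact volume_ne_top_of_norm_lt_one fun x hx => hx.1
  · intro p hp r hr0 hr1
    have hp' : |⟪(p : EuclideanSpace ℝ (Fin n)), θ⟫| < u := hp
    refine ⟨by simpa [norm_smul, abs_of_pos hr0] using hr1, ?_⟩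
    rw [real_inner_smul_left, abs_mul, abs_of_pos hr0]
    exact (mul_le_of_le_one_left (abs_nonneg _) hr1.le).trans_lt hp'

/-- Lower bound for the upper tail of a one-dimensional marginal of the sphere. Most of the ball
lies in a slab of half-width `2 / √n`; shrunk and translated along `θ`, this slab fits into the cap
of height `t`. -/
theorem le_sphereUniform_le_inner {n : ℕ} [NeZero n] {θ : EuclideanSpace ℝ (Fin n)}
    (hθ : ‖θ‖ = 1) {t : ℝ} (ht : 0 < t) (htn : (t + 2 / √n) ^ 2 ≤ 1 / 6) :
    1 / 2 * exp (-24 - 6 * n * t ^ 2) ≤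
      (sphereUniform n).real {p | t ≤ ⟪(p : EuclideanSpace ℝ (Fin n)), θ⟫} := by
  set V := volume.real (ball (0 : EuclideanSpace ℝ (Fin n)) 1) with hV
  have hV0 : 0 < V := volume_unitBall_pos n
  have hn1 : (1 : ℝ) ≤ n := by exact_mod_cast NeZero.one_le
  have hs0 : 0 < √(n : ℝ) := by positivity
  have hsq : √(n : ℝ) ^ 2 = n := sq_sqrt (by positivity)
  set h : ℝ := 2 / √n with hh
  have hh0 : 0 < h := by positivity
  have hh2 : n * h ^ 2 = 4 := by
    rw [hh, div_pow, hsq]; field_simp; norm_num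
  set S := {x : EuclideanSpace ℝ (Fin n) | ‖x‖ < 1 ∧ |⟪x, θ⟫| < h} with hS
  have hSV : V / 2 ≤ volume.real S := by
    have hc := volume_real_le_abs_inner θ hh0 (T := {y | h ≤ |y|})
      (measurableSet_le measurable_const measurable_abs) (fun y hy => hy) (fun y hy r hr0 hr1 => by
        have hy' : h ≤ |y| := hy
        rw [mem_ofPred_eq, abs_div, abs_of_pos hr0]
        exact hy'.trans (le_div_self (abs_nonneg _) hr0 hr1.le))
    have htail := sphereUniform_le_abs_inner hθ hh0.le
    have e : 3 * n * h ^ 2 / 8 = 3 / 2 := by linear_combination 3 / 8 * hh2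
    rw [e] at htail
    have hexp : exp (-(3 / 2 : ℝ)) ≤ 1 / 4 := by
      rw [exp_neg, inv_le_comm₀ (exp_pos _) (by norm_num)]
      have := quadratic_le_exp_of_nonneg (x := 3 / 4) (by norm_num)
      have h2 : exp (3 / 2 : ℝ) = exp (3 / 4) ^ 2 := by rw [← exp_nat_mul]; norm_num
      rw [h2]
      nlinarith
    have hcov : ball (0 : EuclideanSpace ℝ (Fin n)) 1 ⊆
        S ∪ {x : EuclideanSpace ℝ (Fin n) | ‖x‖ < 1 ∧ ⟪x, θ⟫ ∈ {y | h ≤ |y|}} := by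
      intro x hx
      rw [mem_ball_zero_iff] at hx
      rcases lt_or_ge |⟪x, θ⟫| h with h1 | h1
      · exact Or.inl ⟨hx, h1⟩
      · exact Or.inr ⟨hx, h1⟩
    have hfin : volume
        (S ∪ {x : EuclideanSpace ℝ (Fin n) | ‖x‖ < 1 ∧ ⟪x, θ⟫ ∈ {y | h ≤ |y|}}) ≠ ⊤ :=
      volume_ne_top_of_norm_lt_one fun x hx => hx.elim And.left And.left
    have h1 := (measureReal_mono hcov hfin).trans (measureReal_union_le _ _)
    have h2 : (sphereUniform n).real {p | ⟪(p : EuclideanSpace ℝ (Fin n)), θ⟫ ∈ {y | h ≤ |y|}} * V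
        ≤ 1 / 2 * V := by
      refine mul_le_mul_of_nonneg_right (htail.trans ?_) hV0.le
      linarith
    linarith
  set w := t + h with hw
  have hw0 : 0 < w := by positivity
  set ρ := exp (-(3 * w ^ 2)) with hρ
  have hρ0 : 0 < ρ := exp_pos _
  have hρ1 : ρ ≤ 1 := exp_le_one_iff.2 (by nlinarith)
  have hρ2 : ρ ^ 2 ≤ 1 - 3 * w ^ 2 := by
    rw [hρ, ← exp_nat_mul]
    have e1 : exp ((2 : ℕ) * -(3 * w ^ 2)) = (exp (6 * w ^ 2))⁻¹ := by
      rw [← exp_neg]; push_cast; ring_nf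
    rw [e1]
    have h1 := add_one_le_exp (6 * w ^ 2)
    refine inv_le_of_inv_le₀ (by linarith) (le_trans ?_ h1)
    rw [inv_le_iff_one_le_mul₀ (by linarith)]
    nlinarith [mul_nonneg (sq_nonneg w) (sub_nonneg.2 htn)]
  have himg : (fun x => ρ • x + w • θ) '' S ⊆
      {x : EuclideanSpace ℝ (Fin n) | ‖x‖ < 1 ∧ ⟪x, θ⟫ ∈ Ici t} := by
    rintro _ ⟨x, hx, rfl⟩
    have hx1 : ‖x‖ ^ 2 < 1 := by
      have := hx.1
      nlinarith [norm_nonneg x]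
    obtain ⟨hl, hu⟩ := abs_lt.1 hx.2
    constructor
    · refine lt_of_pow_lt_pow_left₀ 2 zero_le_one ?_
      have e : ‖ρ • x + w • θ‖ ^ 2 = ρ ^ 2 * ‖x‖ ^ 2 + 2 * (ρ * w) * ⟪x, θ⟫ + w ^ 2 := by
        simp only [norm_add_sq_real, norm_smul, real_inner_smul_left, real_inner_smul_right, hθ,
          norm_eq_abs, mul_pow, sq_abs]
        ring
      have hc : ρ * w * ⟪x, θ⟫ ≤ w * w :=
        calc ρ * w * ⟪x, θ⟫ ≤ ρ * w * w := by
              refine mul_le_mul_of_nonneg_left (by linarith) (by positivity)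
          _ ≤ 1 * w * w := by gcongr
          _ = w * w := by ring
      rw [e]
      have : ρ ^ 2 * ‖x‖ ^ 2 < ρ ^ 2 := by
        have := pow_pos hρ0 2
        nlinarith
      linarith
    · rw [mem_Ici, inner_add_left, real_inner_smul_left, real_inner_smul_left,
        real_inner_self_eq_norm_sq, hθ]
      nlinarith
  have hcone := volume_real_le_abs_inner θ ht (T := Ici t) measurableSet_Ici
    (fun y hy => (mem_Ici.1 hy).trans (le_abs_self y)) (fun y hy r hr0 hr1 =>
      (mem_Ici.1 hy).trans (le_div_self (ht.le.trans hy) hr0 hr1.le))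
  have hmono := measureReal_mono (μ := volume) himg
    (volume_ne_top_of_norm_lt_one fun x hx => hx.1)
  rw [volume_real_affine_image hρ0.le] at hmono
  have hpow : exp (-24 - 6 * n * t ^ 2) ≤ ρ ^ n := by
    rw [hρ, ← exp_nat_mul, exp_le_exp, hw]
    nlinarith [mul_nonneg (Nat.cast_nonneg (α := ℝ) n) (sq_nonneg (t - h))]
  refine le_of_mul_le_mul_right ?_ hV0
  calc 1 / 2 * exp (-24 - 6 * n * t ^ 2) * V = exp (-24 - 6 * n * t ^ 2) * (V / 2) := by ring
    _ ≤ ρ ^ n * volume.real S := by gcongr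
    _ ≤ _ := hmono.trans hcone

/-! ### Exponential moments from tail bounds -/

/-- A tail `2 e ^ (-3x)` yields an exponential moment at most `2`, by the layer-cake formula. -/
theorem integral_exp_le_two_of_tail {Ω : Type*} [MeasurableSpace Ω] {μ : Measure Ω}
    [IsProbabilityMeasure μ] {Z : Ω → ℝ} (hint : Integrable (fun ω => exp (Z ω)) μ)
    (htail : ∀ x, 0 ≤ x → μ.real {ω | x ≤ Z ω} ≤ 2 * exp (-(3 * x))) :
    ∫ ω, exp (Z ω) ∂μ ≤ 2 := by
  rw [hint.integral_eq_integral_meas_lt (ae_of_all _ fun ω => (exp_pos _).le)]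
  have hrpow : IntegrableOn (fun t : ℝ => 2 * t ^ (-3 : ℝ)) (Ioi 1) :=
    (integrableOn_Ioi_rpow_of_lt (by norm_num) one_pos).const_mul 2
  have hone : IntegrableOn (fun _ : ℝ => (1 : ℝ)) (Ioc 0 1) := by simp
  let h : ℝ → ℝ := fun t => (Ioc (0 : ℝ) 1).indicator (fun _ => 1) t +
    (Ioi (1 : ℝ)).indicator (fun t => 2 * t ^ (-3 : ℝ)) t
  have h1 : Integrable ((Ioc (0 : ℝ) 1).indicator fun _ => (1 : ℝ)) :=
    (integrable_indicator_iff measurableSet_Ioc).2 hone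
  have h2 : Integrable ((Ioi (1 : ℝ)).indicator fun t : ℝ => 2 * t ^ (-3 : ℝ)) :=
    (integrable_indicator_iff measurableSet_Ioi).2 hrpow
  have hle : ∀ t ∈ Ioi (0 : ℝ), μ.real {ω | t < exp (Z ω)} ≤ h t := by
    intro t ht
    have ht0 : 0 < t := ht
    rcases le_or_gt t 1 with ht1 | ht1
    · have hh : h t = 1 := by simp [h, ht0, ht1, not_lt.2 ht1]
      rw [hh]
      exact measureReal_le_one
    · have hh : h t = 2 * t ^ (-3 : ℝ) := by simp [h, ht1, not_le.2 ht1]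
      rw [hh]
      calc μ.real {ω | t < exp (Z ω)} ≤ μ.real {ω | log t ≤ Z ω} :=
            measureReal_mono fun ω hω => ((log_lt_iff_lt_exp ht0).2 hω).le
        _ ≤ _ := htail _ (log_nonneg ht1.le)
        _ = _ := by rw [rpow_def_of_pos ht0]; ring_nf
  calc ∫ t in Ioi 0, μ.real {ω | t < exp (Z ω)} ≤ ∫ t in Ioi 0, h t :=
        integral_mono_of_nonneg (ae_of_all _ fun t => measureReal_nonneg)
          (h1.add h2).integrableOn ((ae_restrict_iff' measurableSet_Ioi).2 (ae_of_all _ hle))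
    _ ≤ ∫ t, h t := by
        refine setIntegral_le_integral (h1.add h2) (ae_of_all _ fun t => ?_)
        refine add_nonneg (indicator_nonneg (fun _ _ => zero_le_one) t)
          (indicator_nonneg (fun s hs => ?_) t)
        have : (0 : ℝ) < s := one_pos.trans hs
        positivity
    _ = 2 := by
        simp only [h]
        rw [integral_add h1 h2, integral_indicator measurableSet_Ioc,
          integral_indicator measurableSet_Ioi, integral_const_mul,
          integral_Ioi_rpow_of_lt (by norm_num) one_pos]
        norm_num

/-- A small-ball bound `μ {Z < u} ≤ D u` yields the Laplace transform bound `E e ^ (-Z) ≤ D`, by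
the layer-cake formula and `∫₀¹ log (1 / t) dt = 1`. -/
theorem integral_exp_neg_le_of_smallBall {Ω : Type*} [MeasurableSpace Ω] {μ : Measure Ω}
    [IsProbabilityMeasure μ] {Z : Ω → ℝ} (hint : Integrable (fun ω => exp (-Z ω)) μ)
    (hZ : ∀ ω, 0 ≤ Z ω) {D : ℝ} (hD : 0 ≤ D) (hsmall : ∀ u, 0 < u → μ.real {ω | Z ω < u} ≤ D * u) :
    ∫ ω, exp (-Z ω) ∂μ ≤ D := by
  rw [hint.integral_eq_integral_meas_lt (ae_of_all _ fun ω => (exp_pos _).le)]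
  have hlog : IntegrableOn (fun t : ℝ => D * -log t) (Ioc 0 1) := by
    have : IntervalIntegrable log volume 0 1 := intervalIntegral.intervalIntegrable_log'
    exact (((intervalIntegrable_iff_integrableOn_Ioc_of_le zero_le_one).1 this).neg).const_mul D
  have h1 : Integrable ((Ioc (0 : ℝ) 1).indicator fun t => D * -log t) :=
    (integrable_indicator_iff measurableSet_Ioc).2 hlog
  have hnn : ∀ t, 0 ≤ (Ioc (0 : ℝ) 1).indicator (fun t => D * -log t) t := fun t =>
    indicator_nonneg (fun s hs => mul_nonneg hD (neg_nonneg.2 (log_nonpos hs.1.le hs.2))) t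
  have hle : ∀ t ∈ Ioi (0 : ℝ), μ.real {ω | t < exp (-Z ω)} ≤
      (Ioc (0 : ℝ) 1).indicator (fun t => D * -log t) t := by
    intro t ht
    have ht0 : 0 < t := ht
    rcases lt_or_ge t 1 with ht1 | ht1
    · rw [indicator_of_mem (mem_Ioc.2 ⟨ht0, ht1.le⟩)]
      calc μ.real {ω | t < exp (-Z ω)} ≤ μ.real {ω | Z ω < -log t} :=
            measureReal_mono fun ω hω => by
              have := (log_lt_iff_lt_exp ht0).2 hω
              exact lt_neg_of_lt_neg this
        _ ≤ _ := hsmall _ (neg_pos.2 (log_neg ht0 ht1))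
    · have : {ω | t < exp (-Z ω)} = ∅ := by
        ext ω
        simp only [mem_ofPred_eq, mem_empty_iff_false, iff_false, not_lt]
        exact (exp_le_one_iff.2 (neg_nonpos.2 (hZ ω))).trans ht1
      rw [this, measureReal_empty]
      exact hnn t
  calc ∫ t in Ioi 0, μ.real {ω | t < exp (-Z ω)}
      ≤ ∫ t in Ioi 0, (Ioc (0 : ℝ) 1).indicator (fun t => D * -log t) t :=
        integral_mono_of_nonneg (ae_of_all _ fun t => measureReal_nonneg)
          h1.integrableOn ((ae_restrict_iff' measurableSet_Ioi).2 (ae_of_all _ hle))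
    _ ≤ ∫ t, (Ioc (0 : ℝ) 1).indicator (fun t => D * -log t) t :=
        setIntegral_le_integral h1 (ae_of_all _ hnn)
    _ = D := by
        rw [integral_indicator measurableSet_Ioc, integral_const_mul, integral_neg,
          ← intervalIntegral.integral_of_le zero_le_one, integral_log]
        simp

/-! ### The maximum over a block of points -/

theorem integrable_of_continuous_sphere {n k : ℕ} [NeZero n]
    {f : (Fin k → sphere (0 : EuclideanSpace ℝ (Fin n)) 1) → ℝ} (hf : Continuous f) :
    Integrable f (Measure.pi fun _ => sphereUniform n) := by
  obtain ⟨C, hC⟩ := isCompact_univ.exists_bound_of_continuousOn hf.continuousOn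
  exact Integrable.of_bound hf.aestronglyMeasurable C (ae_of_all _ fun x => hC x (mem_univ x))

/-- The largest absolute value `max_j |⟪p_j, θ⟫|`, encoded as the sup norm on `Fin k → ℝ`, which is
`0` for `k = 0`. -/
noncomputable def blockMax {n k : ℕ} (p : Fin k → sphere (0 : EuclideanSpace ℝ (Fin n)) 1)
    (θ : EuclideanSpace ℝ (Fin n)) : ℝ :=
  ‖fun j => ⟪(p j : EuclideanSpace ℝ (Fin n)), θ⟫‖

section blockMax

variable {n k : ℕ}

theorem blockMax_nonneg (p : Fin k → sphere (0 : EuclideanSpace ℝ (Fin n)) 1)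
    (θ : EuclideanSpace ℝ (Fin n)) : 0 ≤ blockMax p θ := norm_nonneg _

theorem blockMax_add_le (p : Fin k → sphere (0 : EuclideanSpace ℝ (Fin n)) 1)
    (θ η : EuclideanSpace ℝ (Fin n)) : blockMax p (θ + η) ≤ blockMax p θ + blockMax p η := by
  have : (fun j => ⟪(p j : EuclideanSpace ℝ (Fin n)), θ + η⟫) =
    (fun j => ⟪(p j : EuclideanSpace ℝ (Fin n)), θ⟫) +
      fun j => ⟪(p j : EuclideanSpace ℝ (Fin n)), η⟫ := by
    ext j; simp [inner_add_right]
  rw [blockMax, this]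
  exact norm_add_le _ _

theorem blockMax_smul (p : Fin k → sphere (0 : EuclideanSpace ℝ (Fin n)) 1) (c : ℝ)
    (θ : EuclideanSpace ℝ (Fin n)) : blockMax p (c • θ) = |c| * blockMax p θ := by
  have : (fun j => ⟪(p j : EuclideanSpace ℝ (Fin n)), c • θ⟫) =
    c • fun j => ⟪(p j : EuclideanSpace ℝ (Fin n)), θ⟫ := by
    ext j; simp [inner_smul_right]
  rw [blockMax, this, norm_smul, norm_eq_abs, blockMax]

theorem continuous_blockMax_left (θ : EuclideanSpace ℝ (Fin n)) :
    Continuous fun p : Fin k → sphere (0 : EuclideanSpace ℝ (Fin n)) 1 => blockMax p θ := by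
  unfold blockMax; fun_prop

theorem continuous_blockMax_right (p : Fin k → sphere (0 : EuclideanSpace ℝ (Fin n)) 1) :
    Continuous (blockMax p) := by
  unfold blockMax; fun_prop

theorem abs_inner_le_blockMax (p : Fin k → sphere (0 : EuclideanSpace ℝ (Fin n)) 1)
    (θ : EuclideanSpace ℝ (Fin n)) (j : Fin k) :
    |⟪(p j : EuclideanSpace ℝ (Fin n)), θ⟫| ≤ blockMax p θ :=
  norm_le_pi_norm (fun j => ⟪(p j : EuclideanSpace ℝ (Fin n)), θ⟫) j

theorem blockMax_le_iff (p : Fin k → sphere (0 : EuclideanSpace ℝ (Fin n)) 1)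
    (θ : EuclideanSpace ℝ (Fin n)) {r : ℝ} (hr : 0 ≤ r) :
    blockMax p θ ≤ r ↔ ∀ j, |⟪(p j : EuclideanSpace ℝ (Fin n)), θ⟫| ≤ r :=
  pi_norm_le_iff_of_nonneg hr

variable [NeZero n] {θ : EuclideanSpace ℝ (Fin n)}

theorem integral_exp_sq_inner_le (hθ : ‖θ‖ = 1) :
    ∫ p : sphere (0 : EuclideanSpace ℝ (Fin n)) 1,
      exp (n * ⟪(p : EuclideanSpace ℝ (Fin n)), θ⟫ ^ 2 / 8) ∂(sphereUniform n) ≤ 2 := by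
  have hn1 : (1 : ℝ) ≤ n := by exact_mod_cast NeZero.one_le
  refine integral_exp_le_two_of_tail ?_ fun x hx => ?_
  · have hc : Continuous fun p : sphere (0 : EuclideanSpace ℝ (Fin n)) 1 =>
      exp (n * ⟪(p : EuclideanSpace ℝ (Fin n)), θ⟫ ^ 2 / 8) := by fun_prop
    obtain ⟨C, hC⟩ := isCompact_univ.exists_bound_of_continuousOn hc.continuousOn
    exact Integrable.of_bound hc.aestronglyMeasurable C (ae_of_all _ fun x => hC x (mem_univ x))
  · have h := sphereUniform_le_abs_inner hθ (sqrt_nonneg (8 * x / n))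
    rw [sq_sqrt (by positivity)] at h
    have e : 3 * n * (8 * x / n) / 8 = 3 * x := by field_simp
    rw [e] at h
    refine le_trans (measureReal_mono fun p hp => ?_) h
    have hp' : x ≤ n * ⟪(p : EuclideanSpace ℝ (Fin n)), θ⟫ ^ 2 / 8 := hp
    rw [mem_ofPred_eq, sqrt_le_left (abs_nonneg _), sq_abs, div_le_iff₀ (by positivity)]
    linarith

/-- The exponential of the maximum is at most the sum of the exponentials. -/
theorem integral_exp_sq_blockMax_le (hθ : ‖θ‖ = 1) (hk : 0 < k) :
    ∫ p, exp (n * blockMax p θ ^ 2 / 8) ∂(Measure.pi fun _ : Fin k => sphereUniform n) ≤ 2 * k := by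
  have hcj : ∀ j : Fin k, Continuous fun p : Fin k → sphere (0 : EuclideanSpace ℝ (Fin n)) 1 =>
      exp (n * ⟪(p j : EuclideanSpace ℝ (Fin n)), θ⟫ ^ 2 / 8) := fun j => by fun_prop
  have : Nonempty (Fin k) := ⟨⟨0, hk⟩⟩
  calc ∫ p, exp (n * blockMax p θ ^ 2 / 8) ∂(Measure.pi fun _ : Fin k => sphereUniform n)
      ≤ ∫ p, ∑ j : Fin k, exp (n * ⟪(p j : EuclideanSpace ℝ (Fin n)), θ⟫ ^ 2 / 8)
          ∂(Measure.pi fun _ : Fin k => sphereUniform n) := by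
        refine integral_mono (integrable_of_continuous_sphere ?_)
          (integrable_of_continuous_sphere ?_) fun p => ?_
        · have := continuous_blockMax_left (k := k) θ
          fun_prop
        · fun_prop
        · obtain ⟨j, hj⟩ := Finite.exists_max fun j => |⟪(p j : EuclideanSpace ℝ (Fin n)), θ⟫|
          have hb : blockMax p θ = |⟪(p j : EuclideanSpace ℝ (Fin n)), θ⟫| :=
            le_antisymm ((blockMax_le_iff p θ (abs_nonneg _)).2 hj) (abs_inner_le_blockMax p θ j)
          simp only [hb, sq_abs]
          exact Finset.single_le_sum
            (f := fun j => exp (n * ⟪(p j : EuclideanSpace ℝ (Fin n)), θ⟫ ^ 2 / 8))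
            (fun _ _ => (exp_pos _).le) (Finset.mem_univ j)
    _ = ∑ j : Fin k, ∫ p, exp (n * ⟪(p : EuclideanSpace ℝ (Fin n)), θ⟫ ^ 2 / 8)
          ∂(sphereUniform n) := by
        rw [integral_finsetSum _ fun j _ => integrable_of_continuous_sphere (hcj j)]
        refine Finset.sum_congr rfl fun j _ => ?_
        exact integral_comp_eval (μ := fun _ : Fin k => sphereUniform n) (i := j)
          (f := fun p : sphere (0 : EuclideanSpace ℝ (Fin n)) 1 =>
            exp (n * ⟪(p : EuclideanSpace ℝ (Fin n)), θ⟫ ^ 2 / 8))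
          (Continuous.aestronglyMeasurable (by fun_prop))
    _ ≤ ∑ j : Fin k, 2 := Finset.sum_le_sum fun _ _ => integral_exp_sq_inner_le hθ
    _ = 2 * k := by simp [mul_comm]

theorem integral_exp_neg_blockMax_one_le (hθ : ‖θ‖ = 1) {a : ℝ} (ha : 0 < a) :
    ∫ p, exp (-(blockMax p θ / a)) ∂(Measure.pi fun _ : Fin 1 => sphereUniform n) ≤ 8 * √n * a := by
  refine integral_exp_neg_le_of_smallBall (integrable_of_continuous_sphere ?_)
    (fun p => div_nonneg (blockMax_nonneg p θ) ha.le) (by positivity) fun u hu => ?_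
  · have := continuous_blockMax_left (k := 1) θ
    fun_prop
  · have hset : {p : Fin 1 → sphere (0 : EuclideanSpace ℝ (Fin n)) 1 | blockMax p θ / a < u} ⊆
        univ.pi fun _ => {p | |⟪(p : EuclideanSpace ℝ (Fin n)), θ⟫| < a * u} := by
      intro p hp j _
      have hp' : blockMax p θ / a < u := hp
      rw [div_lt_iff₀ ha, mul_comm] at hp'
      exact (abs_inner_le_blockMax p θ j).trans_lt hp'
    refine (measureReal_mono hset).trans ?_
    rw [measureReal_def, Measure.pi_pi]
    simp only [Finset.univ_unique, Finset.prod_const, Finset.card_singleton, pow_one]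
    refine (sphereUniform_abs_inner_lt hθ (mul_pos ha hu)).trans_eq ?_
    ring

/-- Laplace transform of the maximum of `k` independent marginals: the maximum is below `t` only
with probability `(1 - q) ^ k`, where `q` is the tail of one marginal at `t`. -/
theorem integral_exp_neg_blockMax_le (hθ : ‖θ‖ = 1) {a t : ℝ} (ha : 0 < a) (ht : 0 < t)
    (htn : (t + 2 / √n) ^ 2 ≤ 1 / 6) :
    ∫ p, exp (-(blockMax p θ / a)) ∂(Measure.pi fun _ : Fin k => sphereUniform n) ≤
      exp (-(k * (1 / 2 * exp (-24 - 6 * n * t ^ 2)))) + exp (-(t / a)) := by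
  set q := 1 / 2 * exp (-24 - 6 * n * t ^ 2) with hq
  set B : Set (sphere (0 : EuclideanSpace ℝ (Fin n)) 1) :=
    {p | ⟪(p : EuclideanSpace ℝ (Fin n)), θ⟫ < t} with hB
  have hBm : MeasurableSet B :=
    measurableSet_lt (Continuous.measurable (by fun_prop)) measurable_const
  have hBc : (sphereUniform n).real B ≤ exp (-q) := by
    have h1 := le_sphereUniform_le_inner hθ ht htn
    have h2 : {p : sphere (0 : EuclideanSpace ℝ (Fin n)) 1 |
        t ≤ ⟪(p : EuclideanSpace ℝ (Fin n)), θ⟫} = Bᶜ := by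
      ext p; simp [hB]
    rw [h2, probReal_compl_eq_one_sub hBm] at h1
    have := add_one_le_exp (-q)
    linarith
  set A : Set (Fin k → sphere (0 : EuclideanSpace ℝ (Fin n)) 1) := univ.pi fun _ => B with hA
  have hAm : MeasurableSet A := MeasurableSet.univ_pi fun _ => hBm
  have hAr : (Measure.pi fun _ : Fin k => sphereUniform n).real A ≤ exp (-(k * q)) := by
    rw [measureReal_def, Measure.pi_pi]
    simp only [Finset.prod_const, Finset.card_univ, Fintype.card_fin, ENNReal.toReal_pow]
    calc _ ≤ exp (-q) ^ k := pow_le_pow_left₀ ENNReal.toReal_nonneg hBc k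
      _ = _ := by rw [← exp_nat_mul]; ring_nf
  have hc := continuous_blockMax_left (k := k) θ
  have hAi : Integrable (A.indicator (fun _ => (1 : ℝ)))
      (Measure.pi fun _ : Fin k => sphereUniform n) :=
    (integrable_const (1 : ℝ)).indicator hAm
  calc ∫ p, exp (-(blockMax p θ / a)) ∂(Measure.pi fun _ : Fin k => sphereUniform n)
      ≤ ∫ p, (A.indicator (fun _ => (1 : ℝ)) p + exp (-(t / a)))
          ∂(Measure.pi fun _ : Fin k => sphereUniform n) := by
        refine integral_mono (integrable_of_continuous_sphere (by fun_prop))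
          (hAi.add (integrable_const _)) fun p => ?_
        by_cases hp : p ∈ A
        · simp only [indicator_of_mem hp]
          have : exp (-(blockMax p θ / a)) ≤ 1 :=
            exp_le_one_iff.2 (neg_nonpos.2 (div_nonneg (blockMax_nonneg p θ) ha.le))
          have := exp_pos (-(t / a))
          linarith
        · simp only [indicator_of_notMem hp, zero_add, exp_le_exp, neg_le_neg_iff]
          have : ∃ j, t ≤ ⟪(p j : EuclideanSpace ℝ (Fin n)), θ⟫ := by
            by_contra hcon
            push Not at hcon
            exact hp fun j _ => hcon j
          obtain ⟨j, hj⟩ := this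
          have := hj.trans ((le_abs_self _).trans (abs_inner_le_blockMax p θ j))
          gcongr
    _ = (Measure.pi fun _ : Fin k => sphereUniform n).real A + exp (-(t / a)) := by
        rw [integral_add hAi (integrable_const _),
          integral_indicator_const _ hAm]
        simp
    _ ≤ _ := by gcongr

end blockMax

/-! ### Nets of the sphere and seminorms -/

/-- Volume bound for separated sets on the unit sphere. -/
theorem card_le_of_separated_unitSphere {n : ℕ} {ε : ℝ} (hε : 0 < ε)
    {F : Finset (EuclideanSpace ℝ (Fin n))} (hF : ∀ x ∈ F, ‖x‖ = 1)
    (hsep : ∀ x ∈ F, ∀ y ∈ F, x ≠ y → ε ≤ ‖x - y‖) : (F.card : ℝ) ≤ (1 + 2 / ε) ^ n := by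
  have hdisj : (F : Set (EuclideanSpace ℝ (Fin n))).PairwiseDisjoint fun x => ball x (ε / 2) := by
    intro x hx y hy hxy
    refine ball_disjoint_ball ?_
    rw [dist_eq_norm]
    have := hsep x hx y hy hxy
    linarith
  have hsub : (⋃ x ∈ F, ball x (ε / 2)) ⊆ ball (0 : EuclideanSpace ℝ (Fin n)) (1 + ε / 2) := by
    refine iUnion₂_subset fun x hx => ball_subset_ball' ?_
    rw [dist_zero_right, hF x hx, add_comm]
  have h := measureReal_mono (μ := volume) hsub measure_ball_lt_top.ne
  rw [measureReal_biUnion_finset hdisj (fun _ _ => measurableSet_ball)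
    (fun _ _ => measure_ball_lt_top.ne)] at h
  simp only [measureReal_def, Measure.addHaar_ball_of_pos _ _ (half_pos hε),
    Measure.addHaar_ball_of_pos _ _ (show 0 < 1 + ε / 2 by positivity), ENNReal.toReal_mul,
    Finset.sum_const, nsmul_eq_mul, finrank_euclideanSpace, Fintype.card_fin] at h
  rw [ENNReal.toReal_ofReal (by positivity), ENNReal.toReal_ofReal (by positivity), ← mul_assoc]
    at h
  have h' := le_of_mul_le_mul_right h (volume_unitBall_pos n)
  have e : (1 : ℝ) + 2 / ε = (1 + ε / 2) / (ε / 2) := by field_simp; ring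
  rwa [e, div_pow, le_div_iff₀ (by positivity)]

/-- The unit sphere of `ℝⁿ` has an `ε`-net of at most `(1 + 2 / ε) ^ n` points. -/
theorem exists_net_unitSphere (n : ℕ) {ε : ℝ} (hε : 0 < ε) :
    ∃ F : Finset (EuclideanSpace ℝ (Fin n)), (∀ x ∈ F, ‖x‖ = 1) ∧
      (∀ θ : EuclideanSpace ℝ (Fin n), ‖θ‖ = 1 → ∃ x ∈ F, ‖θ - x‖ ≤ ε) ∧
      (F.card : ℝ) ≤ (1 + 2 / ε) ^ n := by
  classical
  let p : Finset (EuclideanSpace ℝ (Fin n)) → Prop := fun F =>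
    (∀ x ∈ F, ‖x‖ = 1) ∧ ∀ x ∈ F, ∀ y ∈ F, x ≠ y → ε ≤ ‖x - y‖
  let C : Set ℕ := {c | ∃ F, p F ∧ F.card = c}
  have hCne : C.Nonempty := ⟨0, ∅, ⟨by simp, by simp⟩, rfl⟩
  have hCb : BddAbove C := by
    refine ⟨⌊(1 + 2 / ε) ^ n⌋₊, ?_⟩
    rintro _ ⟨F, hF, rfl⟩
    exact Nat.le_floor (card_le_of_separated_unitSphere hε hF.1 hF.2)
  obtain ⟨F, hF, hFc⟩ := Nat.sSup_mem hCne hCb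
  refine ⟨F, hF.1, fun θ hθ => ?_, card_le_of_separated_unitSphere hε hF.1 hF.2⟩
  by_contra hcon
  push Not at hcon
  have hθF : θ ∉ F := fun h => by
    have := hcon θ h
    rw [sub_self, norm_zero] at this
    linarith
  have hins : p (insert θ F) := by
    refine ⟨by simpa [hθ] using hF.1, ?_⟩
    intro x hx y hy hxy
    rcases Finset.mem_insert.1 hx with rfl | hx' <;> rcases Finset.mem_insert.1 hy with rfl | hy'
    · exact absurd rfl hxy
    · exact (hcon y hy').le
    · rw [norm_sub_rev]; exact (hcon x hx').le
    · exact hF.2 x hx' y hy' hxy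
  have := le_csSup hCb ⟨_, hins, rfl⟩
  rw [Finset.card_insert_of_notMem hθF, ← hFc] at this
  omega

/-- A seminorm is controlled by its values on a `1 / 2`-net of the sphere. -/
theorem Seminorm.le_of_le_on_net {n : ℕ} [NeZero n] (f : Seminorm ℝ (EuclideanSpace ℝ (Fin n)))
    (hf : Continuous f) {F : Set (EuclideanSpace ℝ (Fin n))}
    (hnet : ∀ θ : EuclideanSpace ℝ (Fin n), ‖θ‖ = 1 → ∃ x ∈ F, ‖θ - x‖ ≤ 1 / 2)
    {A : ℝ} (hA : ∀ x ∈ F, f x ≤ A) (x : EuclideanSpace ℝ (Fin n)) : f x ≤ 2 * A * ‖x‖ := by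
  -- At a maximizer `θ` on the sphere, `f θ ≤ A + f θ / 2`.
  obtain ⟨θ, hθ, hmax⟩ := (isCompact_sphere (0 : EuclideanSpace ℝ (Fin n)) 1).exists_isMaxOn
    (NormedSpace.sphere_nonempty.2 zero_le_one) hf.continuousOn
  have hθ1 : ‖θ‖ = 1 := mem_sphere_zero_iff_norm.1 hθ
  have hhom : ∀ y, f y ≤ f θ * ‖y‖ := by
    intro y
    rcases eq_or_ne y 0 with rfl | hy
    · simp
    · have hy0 : 0 < ‖y‖ := norm_pos_iff.2 hy
      have h : f (‖y‖⁻¹ • y) ≤ f θ := hmax (by simp [norm_smul, hy0.ne'])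
      rw [map_smul_eq_mul, norm_inv, norm_norm, inv_mul_le_iff₀ hy0] at h
      linarith
  obtain ⟨z, hz, hdist⟩ := hnet θ hθ1
  have h1 : f θ ≤ f z + f (θ - z) := by
    have := map_add_le_add f z (θ - z)
    rwa [add_sub_cancel] at this
  have h2 : f (θ - z) ≤ f θ * (1 / 2) :=
    (hhom _).trans (mul_le_mul_of_nonneg_left hdist (apply_nonneg f θ))
  have h3 : f θ ≤ 2 * A := by linarith [hA z hz]
  exact (hhom x).trans (mul_le_mul_of_nonneg_right h3 (norm_nonneg x))

/-- A seminorm that is bounded on a coarse net and bounded below on a fine net is bounded below on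
the whole sphere. -/
theorem Seminorm.le_of_nets {n : ℕ} [NeZero n] (f : Seminorm ℝ (EuclideanSpace ℝ (Fin n)))
    (hf : Continuous f) {F G : Set (EuclideanSpace ℝ (Fin n))} {ε A a : ℝ}
    (hF : ∀ θ : EuclideanSpace ℝ (Fin n), ‖θ‖ = 1 → ∃ x ∈ F, ‖θ - x‖ ≤ 1 / 2)
    (hG : ∀ θ : EuclideanSpace ℝ (Fin n), ‖θ‖ = 1 → ∃ x ∈ G, ‖θ - x‖ ≤ ε)
    (hA0 : 0 ≤ A) (hA : ∀ x ∈ F, f x ≤ A) (ha : ∀ x ∈ G, a ≤ f x) (hε : 2 * A * ε ≤ a / 2)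
    {θ : EuclideanSpace ℝ (Fin n)} (hθ : ‖θ‖ = 1) : a / 2 ≤ f θ := by
  obtain ⟨z, hz, hdist⟩ := hG θ hθ
  have h1 : f z ≤ f θ + f (z - θ) := by
    have := map_add_le_add f θ (z - θ)
    rwa [add_sub_cancel] at this
  have h2 := f.le_of_le_on_net hf hF hA (z - θ)
  rw [norm_sub_rev] at h2
  have h3 : 2 * A * ‖θ - z‖ ≤ 2 * A * ε := by gcongr
  linarith [ha z hz]

/-! ### The sum over independent blocks -/

/-- Chernoff's bound for a sum of independent copies, on a product space. -/
theorem pi_real_le_sum_le {X : Type*} [MeasurableSpace X] (κ : Measure X) [IsProbabilityMeasure κ]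
    (N : ℕ) {g : X → ℝ} (hint : Integrable (fun x => exp (g x)) κ) {ρ : ℝ}
    (hρ : ∫ x, exp (g x) ∂κ ≤ ρ) (T : ℝ) :
    (Measure.pi fun _ : Fin N => κ).real {p | T * N ≤ ∑ i, g (p i)} ≤ (exp (-T) * ρ) ^ N := by
  have hprod : Integrable (fun p : Fin N → X => ∏ i, exp (g (p i))) (Measure.pi fun _ => κ) :=
    Integrable.fintype_prod fun _ => hint
  have hmk := mul_meas_ge_le_integral_of_nonneg (ε := exp (T * N))
    (ae_of_all _ fun p => Finset.prod_nonneg fun i _ => (exp_pos (g (p i))).le) hprod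
  rw [integral_fintype_prod_eq_prod (fun _ x => exp (g x)), Finset.prod_const, Finset.card_univ,
    Fintype.card_fin] at hmk
  have hset : {p : Fin N → X | T * N ≤ ∑ i, g (p i)} =
      {p | exp (T * N) ≤ ∏ i, exp (g (p i))} := by
    ext p
    rw [mem_ofPred_eq, mem_ofPred_eq, ← exp_sum, exp_le_exp]
  have hpow : (∫ x, exp (g x) ∂κ) ^ N ≤ ρ ^ N :=
    pow_le_pow_left₀ (integral_nonneg fun x => (exp_pos _).le) hρ N
  rw [hset, mul_pow, ← exp_nat_mul]
  have e : exp ((N : ℝ) * -T) = (exp (T * N))⁻¹ := by rw [← exp_neg]; ring_nf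
  rw [e, ← div_eq_inv_mul, le_div_iff₀' (exp_pos _)]
  exact hmk.trans hpow

/-- The sum over the blocks of the largest `|⟪p_ij, θ⟫|` in the block, as a seminorm in `θ`. -/
noncomputable def blockSum {n N k : ℕ}
    (p : Fin N → Fin k → sphere (0 : EuclideanSpace ℝ (Fin n)) 1) :
    Seminorm ℝ (EuclideanSpace ℝ (Fin n)) :=
  Seminorm.of (fun θ => ∑ i, blockMax (p i) θ)
    (fun θ η => by
      rw [← Finset.sum_add_distrib]
      exact Finset.sum_le_sum fun i _ => blockMax_add_le (p i) θ η)
    (fun c θ => by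
      rw [Finset.mul_sum]
      exact Finset.sum_congr rfl fun i _ => blockMax_smul (p i) c θ)

theorem blockSum_apply {n N k : ℕ}
    (p : Fin N → Fin k → sphere (0 : EuclideanSpace ℝ (Fin n)) 1)
    (θ : EuclideanSpace ℝ (Fin n)) : blockSum p θ = ∑ i, blockMax (p i) θ := rfl

theorem continuous_blockSum {n N k : ℕ}
    (p : Fin N → Fin k → sphere (0 : EuclideanSpace ℝ (Fin n)) 1) : Continuous (blockSum p) := by
  change Continuous fun θ => ∑ i, blockMax (p i) θ
  exact continuous_finsetSum _ fun i _ => continuous_blockMax_right (p i)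

section blockSum

variable {n N k : ℕ} [NeZero n] {θ : EuclideanSpace ℝ (Fin n)}

/-- By the arithmetic–geometric mean inequality, a large sum of block maxima forces a large sum of
their squares, to which the exponential square moment applies. -/
theorem pi_real_blockSum_ge_le (hθ : ‖θ‖ = 1) (hk : 0 < k) {T A : ℝ} (hA : 0 < A)
    (hTA : 8 * T = n * A ^ 2) :
    (Measure.pi fun _ : Fin N => Measure.pi fun _ : Fin k => sphereUniform n).real
      {p | A * N ≤ blockSum p θ} ≤ (exp (-T) * (2 * k)) ^ N := by
  have hc := continuous_blockMax_left (k := k) θ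
  refine le_trans (measureReal_mono fun p hp => ?_) (pi_real_le_sum_le _ N
    (integrable_of_continuous_sphere (by fun_prop)) (integral_exp_sq_blockMax_le hθ hk) T)
  have hp' : A * N ≤ ∑ i, blockMax (p i) θ := hp
  have h1 : ∑ i, 2 * A * blockMax (p i) θ ≤ ∑ i, (blockMax (p i) θ ^ 2 + A ^ 2) :=
    Finset.sum_le_sum fun i _ => by nlinarith [sq_nonneg (blockMax (p i) θ - A)]
  rw [← Finset.mul_sum, Finset.sum_add_distrib] at h1
  simp only [Finset.sum_const, Finset.card_univ, Fintype.card_fin, nsmul_eq_mul] at h1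
  have h2 : N * A ^ 2 ≤ ∑ i, blockMax (p i) θ ^ 2 := by nlinarith
  rw [mem_ofPred_eq, ← Finset.sum_div, ← Finset.mul_sum, le_div_iff₀ (by norm_num)]
  have h3 := mul_le_mul_of_nonneg_left h2 (Nat.cast_nonneg (α := ℝ) n)
  calc T * N * 8 = n * (N * A ^ 2) := by linear_combination (N : ℝ) * hTA
    _ ≤ _ := h3

theorem pi_real_blockSum_le_le {a ρ : ℝ} (ha : 0 < a)
    (hρ : ∫ p, exp (-(blockMax p θ / a)) ∂(Measure.pi fun _ : Fin k => sphereUniform n) ≤ ρ) :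
    (Measure.pi fun _ : Fin N => Measure.pi fun _ : Fin k => sphereUniform n).real
      {p | blockSum p θ ≤ a * N} ≤ (exp 1 * ρ) ^ N := by
  have hc := continuous_blockMax_left (k := k) θ
  have h := pi_real_le_sum_le (Measure.pi fun _ : Fin k => sphereUniform n) N
    (integrable_of_continuous_sphere (by fun_prop)) hρ (-1)
  rw [neg_neg] at h
  refine le_trans (measureReal_mono fun p hp => ?_) h
  have hp' : ∑ i, blockMax (p i) θ ≤ a * N := hp
  rw [mem_ofPred_eq, Finset.sum_neg_distrib, ← Finset.sum_div, neg_one_mul, neg_le_neg_iff,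
    div_le_iff₀ ha]
  linarith

/-- The union bound over two nets: a `1 / 2`-net, on which the block seminorm is at most `A N`, and
an `ε`-net, on which it is at least `a N`. Outside the exceptional event, the block seminorm is at
least `a N / 2` on the whole sphere. -/
theorem pi_real_exists_blockSum_lt_le (hk : 0 < k) {T A a ε ρ : ℝ} (hA : 0 < A) (ha : 0 < a)
    (hε : 0 < ε) (hTA : 8 * T = n * A ^ 2) (hAε : 4 * A * ε ≤ a) (hρ0 : 0 ≤ ρ)
    (hρ : ∀ θ : EuclideanSpace ℝ (Fin n), ‖θ‖ = 1 →
      ∫ p, exp (-(blockMax p θ / a)) ∂(Measure.pi fun _ : Fin k => sphereUniform n) ≤ ρ) :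
    (Measure.pi fun _ : Fin N => Measure.pi fun _ : Fin k => sphereUniform n).real
      {p | ∃ θ : EuclideanSpace ℝ (Fin n), ‖θ‖ = 1 ∧ blockSum p θ < a * N / 2} ≤
      5 ^ n * (exp (-T) * (2 * k)) ^ N + (1 + 2 / ε) ^ n * (exp 1 * ρ) ^ N := by
  obtain ⟨F, hF1, hFnet, hFc⟩ := exists_net_unitSphere n (ε := 1 / 2) (by norm_num)
  obtain ⟨G, hG1, hGnet, hGc⟩ := exists_net_unitSphere n hε
  norm_num at hFc
  set ν := Measure.pi fun _ : Fin N => Measure.pi fun _ : Fin k => sphereUniform n with hν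
  have hsub : {p : Fin N → Fin k → sphere (0 : EuclideanSpace ℝ (Fin n)) 1 |
      ∃ θ : EuclideanSpace ℝ (Fin n), ‖θ‖ = 1 ∧ blockSum p θ < a * N / 2} ⊆
      (⋃ x ∈ F, {p | A * N ≤ blockSum p x}) ∪ ⋃ x ∈ G, {p | blockSum p x ≤ a * N} := by
    intro p hp
    by_contra hcon
    simp only [mem_union, mem_iUnion, mem_ofPred_eq, not_or, not_exists, not_le] at hcon
    obtain ⟨θ, hθ, hlt⟩ := hp
    refine absurd (Seminorm.le_of_nets (blockSum p) (continuous_blockSum p) (F := F) (G := G)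
      (A := A * N) (a := a * N) hFnet hGnet (by positivity) (fun x hx => (hcon.1 x hx).le)
      (fun x hx => (hcon.2 x hx).le) ?_ hθ) (not_le.2 hlt)
    nlinarith [mul_le_mul_of_nonneg_right hAε (Nat.cast_nonneg (α := ℝ) N)]
  refine (measureReal_mono hsub).trans ((measureReal_union_le _ _).trans (add_le_add ?_ ?_))
  · calc ν.real (⋃ x ∈ F, {p | A * N ≤ blockSum p x})
        ≤ ∑ x ∈ F, ν.real {p | A * N ≤ blockSum p x} := measureReal_biUnion_finset_le _ _
      _ ≤ ∑ x ∈ F, (exp (-T) * (2 * k)) ^ N :=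
        Finset.sum_le_sum fun x hx => pi_real_blockSum_ge_le (hF1 x hx) hk hA hTA
      _ ≤ _ := by rw [Finset.sum_const, nsmul_eq_mul]; gcongr
  · calc ν.real (⋃ x ∈ G, {p | blockSum p x ≤ a * N})
        ≤ ∑ x ∈ G, ν.real {p | blockSum p x ≤ a * N} := measureReal_biUnion_finset_le _ _
      _ ≤ ∑ x ∈ G, (exp 1 * ρ) ^ N :=
        Finset.sum_le_sum fun x hx => pi_real_blockSum_le_le ha (hρ x (hG1 x hx))
      _ ≤ _ := by rw [Finset.sum_const, nsmul_eq_mul]; gcongr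

end blockSum

/-! ### From the block seminorm to the volume of the hull -/

/-- The support function of the hull dominates the average over the blocks of the block maxima, so
a lower bound `b` for this average on the unit sphere gives, by Hahn–Banach, the inclusion of the
ball of radius `b`. -/
theorem closedBall_subset_symmConvexHull {n m N k : ℕ} (hm : 0 < m) (hN : 0 < N)
    (p : Fin m → sphere (0 : EuclideanSpace ℝ (Fin n)) 1) (g : Fin N → Fin k → Fin m) {b : ℝ}
    (h : ∀ θ : EuclideanSpace ℝ (Fin n), ‖θ‖ = 1 → b * N ≤ blockSum (fun i j => p (g i j)) θ) :
    closedBall 0 b ⊆ symmConvexHull fun i => (p i : EuclideanSpace ℝ (Fin n)) := by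
  intro x hx
  by_contra hxK
  set K := symmConvexHull fun i => (p i : EuclideanSpace ℝ (Fin n)) with hK
  have hcl : IsClosed K :=
    (((finite_range _).union (finite_range _)).isCompact_convexHull ℝ).isClosed
  obtain ⟨f, u, hfK, hfx⟩ := geometric_hahn_banach_closed_point (convex_convexHull ℝ _) hcl hxK
  set v := (InnerProductSpace.toDual ℝ (EuclideanSpace ℝ (Fin n))).symm f with hv
  have hf : ∀ y, f y = ⟪v, y⟫ := fun y => by simp [hv]
  have habs : ∀ i, |⟪(p i : EuclideanSpace ℝ (Fin n)), v⟫| ≤ u := by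
    intro i
    have h1 := hfK _ (subset_convexHull ℝ _ (Or.inl ⟨i, rfl⟩))
    have h2 := hfK _ (subset_convexHull ℝ _ (Or.inr ⟨i, rfl⟩))
    rw [hf, real_inner_comm] at h1 h2
    rw [inner_neg_left] at h2
    exact abs_le.2 ⟨by linarith, h1.le⟩
  have hu : 0 ≤ u := (abs_nonneg _).trans (habs ⟨0, hm⟩)
  have hsum : blockSum (fun i j => p (g i j)) v ≤ N * u := by
    rw [blockSum_apply]
    calc _ ≤ ∑ _i : Fin N, u :=
          Finset.sum_le_sum fun i _ => (blockMax_le_iff _ _ hu).2 fun j => habs _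
      _ = N * u := by simp
  have hv0 : 0 < ‖v‖ := by
    rw [norm_pos_iff]
    intro h0
    rw [hf, h0, inner_zero_left] at hfx
    linarith
  have hunit := h (‖v‖⁻¹ • v) (by rw [norm_smul, norm_inv, norm_norm, inv_mul_cancel₀ hv0.ne'])
  rw [map_smul_eq_mul, norm_inv, norm_norm, le_inv_mul_iff₀ hv0] at hunit
  have hN' : (0 : ℝ) < N := by exact_mod_cast hN
  have h3 : ‖v‖ * b ≤ u := by
    refine le_of_mul_le_mul_right ?_ hN'
    linarith
  have h4 : f x ≤ ‖v‖ * b := by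
    rw [hf]
    exact (real_inner_le_norm _ _).trans
      (mul_le_mul_of_nonneg_left (mem_closedBall_zero_iff.1 hx) hv0.le)
  linarith

/-- A bounded set containing the ball of radius `b` contains the cube of side `2 b / √n`. -/
theorem le_volume_real_rpow_of_closedBall_subset {n : ℕ} [NeZero n] {b : ℝ} (hb : 0 ≤ b)
    {K : Set (EuclideanSpace ℝ (Fin n))} (hK : volume K ≠ ⊤) (h : closedBall 0 b ⊆ K) :
    2 * b / √n ≤ volume.real K ^ (1 / (n : ℝ)) := by
  have hn0 : n ≠ 0 := NeZero.ne n
  have hn : (0 : ℝ) < n := by exact_mod_cast Nat.pos_of_ne_zero hn0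
  have hsq : √(n : ℝ) ^ 2 = n := sq_sqrt hn.le
  set c := b / √n with hc
  have hc0 : 0 ≤ c := by positivity
  have hcube : (WithLp.ofLp ⁻¹' Icc (fun _ => -c) (fun _ => c) : Set (EuclideanSpace ℝ (Fin n))) ⊆
      K := by
    refine Subset.trans (fun x hx => ?_) h
    rw [mem_closedBall_zero_iff]
    refine le_of_sq_le_sq ?_ hb
    rw [EuclideanSpace.norm_sq_eq]
    have hx' : ∀ i, ‖x i‖ ^ 2 ≤ c ^ 2 := fun i => by
      rw [norm_eq_abs]
      exact pow_le_pow_left₀ (abs_nonneg _) (abs_le.2 ⟨hx.1 i, hx.2 i⟩) 2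
    calc _ ≤ ∑ _i : Fin n, c ^ 2 := Finset.sum_le_sum fun i _ => hx' i
      _ = b ^ 2 := by
        rw [Finset.sum_const, Finset.card_univ, Fintype.card_fin, nsmul_eq_mul, hc, div_pow, hsq]
        field_simp
  have hvol : volume.real (WithLp.ofLp ⁻¹' Icc (fun _ => -c) (fun _ => c) :
      Set (EuclideanSpace ℝ (Fin n))) = (2 * c) ^ n := by
    rw [measureReal_def, (PiLp.volume_preserving_ofLp (Fin n)).measure_preimage
      measurableSet_Icc.nullMeasurableSet, Real.volume_Icc_pi_toReal]
    · simp [two_mul]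
    · intro i
      simp only
      linarith
  have hle := measureReal_mono hcube hK
  rw [hvol] at hle
  calc 2 * b / √n = 2 * c := by rw [hc]; ring
    _ = ((2 * c) ^ n) ^ (1 / (n : ℝ)) := by
        rw [one_div, pow_rpow_inv_natCast (by positivity) hn0]
    _ ≤ _ := by gcongr

/-- Arranging `N k` of the points into `N` blocks of `k` points, one may compute probabilities on
the iterated product of the uniform measures. -/
theorem exists_blocks {n m N k : ℕ} [NeZero n] (hNk : N * k ≤ m) :
    ∃ g : Fin N → Fin k → Fin m, ∀ {Ω : Type*} [MeasurableSpace Ω] (μ : Measure Ω)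
      [IsProbabilityMeasure μ] (P : Fin m → Ω → sphere (0 : EuclideanSpace ℝ (Fin n)) 1),
      (∀ i, HasLaw (P i) (sphereUniform n) μ) → iIndepFun P μ →
      ∀ B : Set (Fin N → Fin k → sphere (0 : EuclideanSpace ℝ (Fin n)) 1),
        μ.real {ω | (fun i j => P (g i j) ω) ∈ B} ≤
          (Measure.pi fun _ => Measure.pi fun _ => sphereUniform n).real B := by
  let e : Fin N × Fin k → Fin m := fun q => Fin.castLE hNk (finProdFinEquiv q)
  have he : Function.Injective e := (Fin.castLE_injective hNk).comp finProdFinEquiv.injective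
  refine ⟨fun i j => e (i, j), ?_⟩
  intro Ω _ μ _ P hlaw hind B
  have hX : ∀ q, AEMeasurable (P (e q)) μ := fun q => (hlaw _).aemeasurable
  have hjoint : AEMeasurable (fun ω q => P (e q) ω) μ := aemeasurable_pi_lambda _ hX
  have hmap1 : μ.map (fun ω q => P (e q) ω) = Measure.pi fun _ => sphereUniform n := by
    have := (hind.precomp he).map_fun_eq_pi_map hX
    simp only [(hlaw _).map_eq] at this
    exact this
  have hcurry : (Measure.pi fun _ : Fin N × Fin k => sphereUniform n).map
      (MeasurableEquiv.curry (Fin N) (Fin k) (sphere (0 : EuclideanSpace ℝ (Fin n)) 1)) =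
      Measure.pi fun _ => Measure.pi fun _ => sphereUniform n := by
    have := Measure.infinitePi_map_curry (fun (_ : Fin N) (_ : Fin k) => sphereUniform n)
    simpa only [Measure.infinitePi_eq_pi] using this
  have hmap : μ.map (fun ω i j => P (e (i, j)) ω) =
      Measure.pi fun _ => Measure.pi fun _ => sphereUniform n := by
    rw [← hcurry, ← hmap1, AEMeasurable.map_map_of_aemeasurable
      (MeasurableEquiv.measurable _).aemeasurable hjoint]
    rfl
  have hm : AEMeasurable (fun ω i j => P (e (i, j)) ω) μ :=
    aemeasurable_pi_lambda _ fun i => aemeasurable_pi_lambda _ fun j => hX (i, j)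
  rw [← hmap]
  have := Measure.isProbabilityMeasure_map hm
  exact ENNReal.toReal_mono (measure_ne_top _ _) (Measure.le_map_apply hm B)

/-! ### Estimates for blocks of size one and for large blocks -/

theorem exp_neg_two_mul_add_lt {n : ℕ} (hn : 0 < n) :
    exp (-2) ^ n + exp (-2) ^ n < exp (-(n : ℝ)) := by
  have hn1 : (1 : ℝ) ≤ n := by exact_mod_cast hn
  have h1 : exp (-2) ^ n = exp (-(n : ℝ)) * exp (-(n : ℝ)) := by
    rw [← exp_nat_mul, ← exp_add]; ring_nf
  have h2 : exp (-(n : ℝ)) < 1 / 2 := by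
    rw [exp_neg, inv_lt_comm₀ (exp_pos _) (by norm_num)]
    have := add_one_lt_exp (show (n : ℝ) ≠ 0 by positivity)
    norm_num
    linarith
  rw [h1]
  nlinarith [exp_pos (-(n : ℝ))]

/-- All `m > (1 + δ) n`, with blocks of size one, at scale `1 / √n`. The net has `(C / s) ^ n`
points while the small-ball bound is `(C s) ^ m`; the surplus `(C s) ^ (δ n)` decides how small `s` must
be in terms of `δ`. -/
theorem exists_blockSum_one_bound {δ : ℝ} (hδ : 0 < δ) :
    ∃ s : ℝ, 0 < s ∧ ∀ (n m : ℕ) [NeZero n], (1 + δ) * (n : ℝ) < m →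
      (Measure.pi fun _ : Fin m => Measure.pi fun _ : Fin 1 => sphereUniform n).real
        {p | ∃ θ : EuclideanSpace ℝ (Fin n), ‖θ‖ = 1 ∧ blockSum p θ < s / √n * m / 2} <
        exp (-(n : ℝ)) := by
  -- `y` makes `57 * 22 * y = e⁻²`, where `57 / s` bounds the net base `1 + 56 / s`, and `22 s = z`
  -- bounds the base `8 e s` of the small-ball estimate; `z ^ (1 + δ) = z * y` absorbs the net.
  set y : ℝ := exp (-2) / 1254 with hy
  have hy0 : 0 < y := by positivity
  have hy1 : y ≤ 1 := by
    have : exp (-2) ≤ 1 := exp_le_one_iff.2 (by norm_num)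
    rw [hy, div_le_one (by norm_num)]; linarith
  set z : ℝ := y ^ (1 / δ) with hz
  have hz0 : 0 < z := rpow_pos_of_pos hy0 _
  have hz1 : z ≤ 1 := rpow_le_one hy0.le hy1 (by positivity)
  have hzδ : z ^ δ = y := by
    rw [hz, ← rpow_mul hy0.le, one_div_mul_cancel hδ.ne', rpow_one]
  refine ⟨z / 22, by positivity, fun n m _ hnm => ?_⟩
  set s := z / 22 with hs
  have hs0 : 0 < s := by positivity
  have hn0 : 0 < n := Nat.pos_of_ne_zero (NeZero.ne n)
  have hn : (0 : ℝ) < n := by exact_mod_cast hn0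
  have hsq : √(n : ℝ) ^ 2 = n := sq_sqrt hn.le
  have hsn : 0 < √(n : ℝ) := by positivity
  have hmn : n ≤ m := by
    have : (n : ℝ) ≤ m := by nlinarith
    exact_mod_cast this
  have key := pi_real_exists_blockSum_lt_le (n := n) (N := m) (k := 1) one_pos (T := 49 / 8)
    (A := 7 / √n) (a := s / √n) (ε := s / 28) (ρ := 8 * s) (by positivity) (by positivity)
    (by positivity) (by rw [div_pow, hsq]; field_simp; norm_num)
    (by apply le_of_eq; field_simp; norm_num) (by positivity)
    (fun θ hθ => (integral_exp_neg_blockMax_one_le hθ (by positivity)).trans_eq (by field_simp))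
  refine key.trans_lt (lt_of_le_of_lt (add_le_add ?_ ?_) (exp_neg_two_mul_add_lt hn0))
  · have he : exp (-(49 / 8)) * (2 * (1 : ℕ)) ≤ exp (-2) / 5 := by
      have h1 : exp (-(49 / 8)) ≤ exp (-2) * exp (-4) := by
        rw [← exp_add, exp_le_exp]; norm_num
      have h2 : exp (-4) ≤ 1 / 10 := by
        rw [exp_neg, inv_le_comm₀ (exp_pos _) (by norm_num)]
        have := quadratic_le_exp_of_nonneg (x := 4) (by norm_num)
        linarith
      have := exp_pos (-2)
      push_cast
      nlinarith
    have he1 : exp (-2) / 5 ≤ 1 := by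
      have : exp (-2) ≤ 1 := exp_le_one_iff.2 (by norm_num)
      linarith
    calc (5 : ℝ) ^ n * (exp (-(49 / 8)) * (2 * (1 : ℕ))) ^ m
        ≤ 5 ^ n * (exp (-2) / 5) ^ m := by gcongr
      _ ≤ 5 ^ n * (exp (-2) / 5) ^ n := by
          gcongr ?_ * ?_
          exact pow_le_pow_of_le_one (by positivity) he1 hmn
      _ = exp (-2) ^ n := by rw [← mul_pow]; congr 1; ring
  · have h1 : exp 1 * (8 * s) ≤ z := by
      have := exp_one_lt_d9
      rw [hs]
      nlinarith
    have h2 : 1 + 2 / (s / 28) ≤ 57 * 22 / z := by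
      have : 2 / (s / 28) = 56 * 22 / z := by rw [hs]; field_simp; norm_num
      rw [this, ← sub_nonneg]
      have : 57 * 22 / z - (1 + 56 * 22 / z) = (22 - z) / z := by field_simp; ring
      rw [this]
      exact div_nonneg (by linarith) hz0.le
    have h3 : z ^ m ≤ (z * y) ^ n := by
      rw [← rpow_natCast z m, ← rpow_natCast (z * y) n]
      calc z ^ (m : ℝ) ≤ z ^ ((1 + δ) * n) := rpow_le_rpow_of_exponent_ge hz0 hz1 hnm.le
        _ = (z * y) ^ (n : ℝ) := by
          rw [rpow_mul hz0.le, rpow_add hz0, rpow_one, hzδ]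
    calc (1 + 2 / (s / 28)) ^ n * (exp 1 * (8 * s)) ^ m
        ≤ (57 * 22 / z) ^ n * z ^ m := by gcongr
      _ ≤ (57 * 22 / z) ^ n * (z * y) ^ n := by gcongr
      _ = exp (-2) ^ n := by
        rw [← mul_pow]; congr 1; rw [hy]; field_simp; norm_num

/-- For `n` blocks of `k` points each, `k` large, the block seminorm is of order
`n * √(log k / n)` uniformly on the sphere. -/
theorem blockSum_large_bound {n k : ℕ} [NeZero n] (hk : exp 50 ≤ (k : ℝ))
    (hkn : (k : ℝ) < exp ((n : ℝ) / 2)) :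
    (Measure.pi fun _ : Fin n => Measure.pi fun _ : Fin k => sphereUniform n).real
      {p | ∃ θ : EuclideanSpace ℝ (Fin n), ‖θ‖ = 1 ∧
        blockSum p θ < √(log k / n) / 48 * n / 2} < exp (-(n : ℝ)) := by
  have hn0 : 0 < n := Nat.pos_of_ne_zero (NeZero.ne n)
  have hn : (0 : ℝ) < n := by exact_mod_cast hn0
  have hk0 : (0 : ℝ) < k := (exp_pos _).trans_le hk
  set y := log k with hy
  have hy50 : 50 ≤ y := (le_log_iff_exp_le hk0).2 hk
  have hyn : y < n / 2 := (log_lt_iff_lt_exp hk0).2 hkn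
  have hey : exp y = k := exp_log hk0
  set l := √(y / n) with hl
  have hl0 : 0 < l := sqrt_pos.2 (by positivity)
  have hl2 : n * l ^ 2 = y := by rw [hl, sq_sqrt (by positivity)]; field_simp
  have hlle : l ≤ 71 / 100 := by
    refine le_of_sq_le_sq ?_ (by norm_num)
    nlinarith
  have hsn : 10 ≤ √(n : ℝ) := le_sqrt_of_sq_le (by linarith)
  have hsn2 : 2 / √(n : ℝ) ≤ 1 / 5 := by
    rw [div_le_iff₀ (by positivity)]; linarith
  have htn : (l / 4 + 2 / √(n : ℝ)) ^ 2 ≤ 1 / 6 := by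
    have : 0 ≤ 2 / √(n : ℝ) := by positivity
    nlinarith
  -- With `t = l / 4` the exponent `6 n t²` is `(3 / 8) log k`, so `k` trials of probability about
  -- `k ^ (-3 / 8)` fail together with probability at most `e⁻¹²`, and `exp (-t / a) = e⁻¹²`.
  have hρ : exp (-(k * (1 / 2 * exp (-24 - 6 * n * (l / 4) ^ 2)))) + exp (-(l / 4 / (l / 48)))
      ≤ 2 * exp (-12) := by
    have e1 : l / 4 / (l / 48) = 12 := by field_simp; norm_num
    have e2 : (k : ℝ) * (1 / 2 * exp (-24 - 6 * n * (l / 4) ^ 2)) =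
        1 / 2 * exp (5 / 8 * y - 24) := by
      rw [← hey, mul_left_comm, ← exp_add]
      congr 2
      linear_combination -(3 / 8) * hl2
    have h1 := quadratic_le_exp_of_nonneg (x := 5 / 8 * y - 24) (by linarith)
    have h2 : 12 ≤ 1 / 2 * exp (5 / 8 * y - 24) := by nlinarith
    have h3 : exp (-(1 / 2 * exp (5 / 8 * y - 24))) ≤ exp (-12) := exp_le_exp.2 (by linarith)
    rw [e1, e2]
    linarith
  have key := pi_real_exists_blockSum_lt_le (n := n) (N := n) (k := k)
    (by exact_mod_cast hk0) (T := 2 * y)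
    (A := 4 * l) (a := l / 48) (ε := 1 / 768) (ρ := 2 * exp (-12)) (by positivity) (by positivity)
    (by positivity) (by linear_combination -16 * hl2)
    (by apply le_of_eq; ring) (by positivity)
    (fun θ hθ => (integral_exp_neg_blockMax_le hθ (by positivity) (by positivity) htn).trans hρ)
  refine key.trans_lt (lt_of_le_of_lt (add_le_add ?_ ?_) (exp_neg_two_mul_add_lt hn0))
  · rw [← mul_pow]
    refine pow_le_pow_left₀ (by positivity) ?_ n
    rw [← hey]
    have e1 : 5 * (exp (-(2 * y)) * (2 * exp y)) = 10 * exp (2 - y) * exp (-2) := by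
      have : exp (-(2 * y)) * exp y = exp (2 - y) * exp (-2) := by
        rw [← exp_add, ← exp_add]; ring_nf
      linear_combination 10 * this
    have h2 : exp (2 - y) ≤ 1 / 10 := by
      have e : 2 - y = -(y - 2) := by ring
      rw [e, exp_neg, inv_le_comm₀ (exp_pos _) (by norm_num)]
      have := add_one_le_exp (y - 2)
      linarith
    rw [e1]
    have := exp_pos (-2)
    nlinarith
  · rw [← mul_pow]
    refine pow_le_pow_left₀ (by positivity) ?_ n
    have e1 : (1 + 2 / (1 / 768)) * (exp 1 * (2 * exp (-12))) = 3074 * exp (-9) * exp (-2) := by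
      have : exp 1 * exp (-12) = exp (-9) * exp (-2) := by
        rw [← exp_add, ← exp_add]; norm_num
      linear_combination 3074 * this
    have h2 : 3074 * exp (-9) ≤ 1 := by
      rw [exp_neg, ← div_eq_mul_inv, div_le_one (exp_pos _)]
      have e9 : exp (9 : ℝ) = exp 1 ^ 9 := by rw [← exp_nat_mul]; norm_num
      have h27 : (2.7 : ℝ) ≤ exp 1 := by linarith [exp_one_gt_d9]
      rw [e9]
      calc (3074 : ℝ) ≤ 2.7 ^ 9 := by norm_num
        _ ≤ exp 1 ^ 9 := by gcongr
    rw [e1]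
    exact mul_le_of_le_one_left (exp_pos _).le h2

/-- A lower bound for the block seminorm on the product space yields a lower bound for the volume of
the hull. No measurability of the volume event is needed: its complement is covered by an event of
small outer measure. -/
theorem exp_lt_measureReal_volume {n m N k : ℕ} [NeZero n] (hm : 0 < m) (hN : 0 < N)
    (hNk : N * k ≤ m) {a r : ℝ} (ha : 0 ≤ a) (hr : r ≤ a / √n)
    (hbad : (Measure.pi fun _ : Fin N => Measure.pi fun _ : Fin k => sphereUniform n).real
      {p | ∃ θ : EuclideanSpace ℝ (Fin n), ‖θ‖ = 1 ∧ blockSum p θ < a * N / 2} < exp (-(n : ℝ)))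
    {Ω : Type*} [MeasurableSpace Ω] (μ : Measure Ω) [IsProbabilityMeasure μ]
    (P : Fin m → Ω → sphere (0 : EuclideanSpace ℝ (Fin n)) 1)
    (hlaw : ∀ i, HasLaw (P i) (sphereUniform n) μ) (hind : iIndepFun P μ) :
    1 - exp (-(n : ℝ)) < μ.real {ω | r ≤
      (volume.real (symmConvexHull fun i => (P i ω : EuclideanSpace ℝ (Fin n)))) ^
        (1 / (n : ℝ))} := by
  obtain ⟨g, hg⟩ := exists_blocks (n := n) hNk
  have h1 := hg μ P hlaw hind
    {p | ∃ θ : EuclideanSpace ℝ (Fin n), ‖θ‖ = 1 ∧ blockSum p θ < a * N / 2}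
  set G := {ω | r ≤ (volume.real (symmConvexHull fun i => (P i ω : EuclideanSpace ℝ (Fin n)))) ^
        (1 / (n : ℝ))} with hG
  set B := {ω | (fun i j => P (g i j) ω) ∈
    {p | ∃ θ : EuclideanSpace ℝ (Fin n), ‖θ‖ = 1 ∧ blockSum p θ < a * N / 2}} with hB
  have hcov : univ ⊆ G ∪ B := by
    intro ω _
    by_contra hcon
    rw [mem_union, not_or] at hcon
    obtain ⟨hωG, hωB⟩ := hcon
    refine hωG ?_
    have hall : ∀ θ : EuclideanSpace ℝ (Fin n), ‖θ‖ = 1 →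
        a / 2 * N ≤ blockSum (fun i j => P (g i j) ω) θ := by
      intro θ hθ
      by_contra hlt
      exact hωB ⟨θ, hθ, by linarith⟩
    have hball := closedBall_subset_symmConvexHull hm hN (fun i => P i ω) g hall
    have hfin : volume (symmConvexHull fun i => (P i ω : EuclideanSpace ℝ (Fin n))) ≠ ⊤ :=
      (((finite_range _).union (finite_range _)).isCompact_convexHull ℝ).measure_lt_top.ne
    have hv := le_volume_real_rpow_of_closedBall_subset (by positivity) hfin hball
    refine hr.trans (le_trans (le_of_eq ?_) hv)
    ring
  have h2 := (measureReal_mono (μ := μ) hcov).trans (measureReal_union_le _ _)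
  rw [probReal_univ] at h2
  linarith

theorem lemma2 (δ : ℝ) (hδ : 0 < δ) :
    ∃ c : ℝ, 0 < c ∧
      ∀ (n m : ℕ), (1 + δ) * (n : ℝ) < (m : ℝ) → (m : ℝ) < (n : ℝ) * Real.exp ((n : ℝ) / 2) →
      ∀ {Ω : Type*} [MeasurableSpace Ω] (μ : Measure Ω) [IsProbabilityMeasure μ]
        (P : Fin m → Ω → Metric.sphere (0 : EuclideanSpace ℝ (Fin n)) 1),
        (∀ i, HasLaw (P i) (sphereUniform n) μ) → iIndepFun P μ →
        1 - Real.exp (-(n : ℝ)) <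
          μ.real {ω | c * (Real.sqrt (Real.log ((m : ℝ) / (n : ℝ))) / (n : ℝ)) ≤
            (volume.real (symmConvexHull fun i => (P i ω : EuclideanSpace ℝ (Fin n))))
              ^ (1 / (n : ℝ))} := by
  obtain ⟨s, hs0, hs⟩ := exists_blockSum_one_bound hδ
  refine ⟨min (s / 8) (1 / 96), by positivity, ?_⟩
  intro n m hnm hmn Ω _ μ _ P hlaw hind
  have hn0 : n ≠ 0 := by
    rintro rfl
    simp only [Nat.cast_zero, mul_zero, zero_mul] at hnm hmn
    linarith
  have : NeZero n := ⟨hn0⟩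
  have hn : (0 : ℝ) < n := by exact_mod_cast Nat.pos_of_ne_zero hn0
  have hsn : 0 < √(n : ℝ) := by positivity
  have hsq : √(n : ℝ) * √n = n := mul_self_sqrt hn.le
  have hm : (0 : ℝ) < m := lt_trans (by positivity) hnm
  have hm0 : 0 < m := by exact_mod_cast hm
  rcases lt_or_ge ((m : ℝ) / n) (exp 51) with hsmall | hlarge
  · have hlog : √(log (m / n)) ≤ 8 := by
      refine sqrt_le_iff.2 ⟨by norm_num, ?_⟩
      have := (log_lt_iff_lt_exp (by positivity : (0 : ℝ) < m / n)).2 hsmall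
      linarith
    -- The logarithm is bounded here, so the ball of radius of order `1 / √n` suffices.
    refine exp_lt_measureReal_volume hm0 hm0 (mul_one m).le (a := s / √n) (by positivity) ?_
      (hs n m hnm) μ P hlaw hind
    rw [div_div, hsq, ← mul_div_assoc]
    gcongr
    calc min (s / 8) (1 / 96) * √(log (m / n)) ≤ s / 8 * 8 := by
          gcongr
          exact min_le_left _ _
      _ = s := by ring
  · set k := m / n with hk
    have hkle : (k : ℝ) ≤ m / n := Nat.cast_div_le
    have hklt : (m : ℝ) / n < k + 1 := by
      rw [div_lt_iff₀ hn]
      exact_mod_cast Nat.lt_mul_of_div_lt (Nat.lt_succ_self _) (Nat.pos_of_ne_zero hn0)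
    have h51 : exp 51 = exp 50 * exp 1 := by rw [← exp_add]; norm_num
    have h50 : 1 ≤ exp 50 := one_le_exp (by norm_num)
    have hk50 : exp 50 ≤ k := by
      have := exp_one_gt_d9
      nlinarith
    have hkn : (k : ℝ) < exp ((n : ℝ) / 2) := by
      refine hkle.trans_lt ?_
      rw [div_lt_iff₀ hn]
      linarith
    have hk0 : (0 : ℝ) < k := (exp_pos _).trans_le hk50
    have hlk : 50 ≤ log k := (le_log_iff_exp_le hk0).2 hk50
    have hlog : log (m / n) ≤ 4 * log k := by
      have h1 : (m : ℝ) / n ≤ k ^ 4 := by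
        have h1k : 2 ≤ (k : ℝ) := by
          have := add_one_le_exp (50 : ℝ)
          linarith
        have : (k : ℝ) + 1 ≤ k ^ 2 := by nlinarith
        have : (k : ℝ) ^ 2 ≤ k ^ 4 := pow_le_pow_right₀ (by linarith) (by norm_num)
        linarith
      have := log_le_log (by positivity) h1
      rwa [log_pow] at this
    have hsqrt : √(log (m / n)) ≤ 2 * √(log k) := by
      rw [sqrt_le_left (by positivity), mul_pow, sq_sqrt (by linarith)]
      linarith
    refine exp_lt_measureReal_volume hm0 (Nat.pos_of_ne_zero hn0) (Nat.mul_div_le m n)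
      (a := √(log k / n) / 48) (by positivity) ?_ (blockSum_large_bound hk50 hkn) μ P hlaw hind
    have e : √(log k / n) / 48 / √n = √(log k) / 48 / n := by
      calc √(log k / n) / 48 / √n = √(log k) / 48 / (√n * √n) := by
            rw [sqrt_div (by linarith)]; ring
        _ = _ := by rw [hsq]
    rw [e, ← mul_div_assoc]
    gcongr
    calc min (s / 8) (1 / 96) * √(log (m / n)) ≤ 1 / 96 * (2 * √(log k)) := by
          gcongr
          exact min_le_right _ _
      _ = _ := by ring
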